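/- Graphs are simple, non-empty, locally finite and connected. A graph is called *quasi-transitive* if its automorphism group acts on its vertices with finitely many orbits. For a graph $\mathcal{G}$ and $p\in[0,1]$, Bernoulli bond percolation of parameter $p$ on $\mathcal{G}$ keeps each edge independently with probability $p$ and erases it otherwise; a cluster is a connected component of the resulting random spanning subgraph, and the critical parameter $p_c(\mathcal{G})$ is the supremum of the $p\in[0,1]$ for which there is almost surely no infinite cluster. Let $\mathcal{G}$ be a graph, and let $G\neq\{1\}$ be a group acting on $V(\mathcal{G})$ by graph automorphisms. Let $\mathcal{H}=\mathcal{G}/G$ be the quotient graph: its vertices are the $G$-orbits in $V(\mathcal{G})$, and two distinct orbits are adjacent if and only if some edge of $\mathcal{G}$ intersects both of them. Assume that 1. the action of $G$ on $V(\mathcal{G})$ is free, i.e. $gx\neq x$ for all $g\in G\setminus\{1\}$ and $x\in V(\mathcal{G})$; 2. $\mathcal{G}$ is quasi-transitive; 3. $\mathcal{H}$ is quasi-transitive; 4. $p_c(\mathcal{G})<1$. Then $p_c(\mathcal{G})<p_c(\mathcal{H})$. -/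

import Mathlib

open MeasureTheory ProbabilityTheory

namespace SimpleGraph

/-- A graph is quasi-transitive if its automorphism group acts on its vertices
with finitely many orbits. -/
def IsQuasiTransitive {V : Type*} (𝒢 : SimpleGraph V) : Prop :=
  Finite (MulAction.orbitRel.Quotient (𝒢 ≃g 𝒢) V)

/-- The quotient graph of `𝒢` by a group `Γ` acting on the vertices: its vertices are the orbits,
and two distinct orbits are adjacent iff some edge of `𝒢` joins a point of one
to a point of the other. -/
def orbitQuotient (Γ : Type*) {V : Type*} [Group Γ] [MulAction Γ V] (𝒢 : SimpleGraph V) :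
    SimpleGraph (MulAction.orbitRel.Quotient Γ V) where
  Adj a b := a ≠ b ∧ ∃ x y : V, (⟦x⟧ : MulAction.orbitRel.Quotient Γ V) = a ∧
    (⟦y⟧ : MulAction.orbitRel.Quotient Γ V) = b ∧ 𝒢.Adj x y
  symm := ⟨fun _ _ ⟨hab, x, y, hx, hy, h⟩ => ⟨hab.symm, y, x, hy, hx, h.symm⟩⟩
  loopless := ⟨fun _ h => h.1 rfl⟩

/-- Bernoulli bond percolation of parameter `p`: every edge of `𝒢` is independently open (`true`)
with probability `p` and closed (`false`) with probability `1 - p`. -/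
noncomputable def bondPercolation {V : Type*} (𝒢 : SimpleGraph V) (p : unitInterval) :
    Measure (𝒢.edgeSet → Bool) :=
  Measure.infinitePi fun _ => bernoulliMeasure true false p

/-- The spanning subgraph of `𝒢` formed by the open edges of a configuration. -/
def openSubgraph {V : Type*} (𝒢 : SimpleGraph V) (ω : 𝒢.edgeSet → Bool) : SimpleGraph V where
  Adj x y := ∃ h : 𝒢.Adj x y, ω ⟨s(x, y), h⟩ = true
  symm := ⟨fun x y ⟨h, hω⟩ => ⟨h.symm, by
    have e : (⟨s(y, x), h.symm⟩ : 𝒢.edgeSet) = ⟨s(x, y), h⟩ := Subtype.ext Sym2.eq_swap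
    rw [e]; exact hω⟩⟩
  loopless := ⟨fun _ h => 𝒢.irrefl h.1⟩

/-- The configuration `ω` has an infinite cluster. -/
def HasInfiniteCluster {V : Type*} (𝒢 : SimpleGraph V) (ω : 𝒢.edgeSet → Bool) : Prop :=
  ∃ C : (𝒢.openSubgraph ω).ConnectedComponent, C.supp.Infinite

/-- The critical parameter of bond percolation: the supremum of the `p ∈ [0, 1]` for which
there is almost surely no infinite cluster. -/
noncomputable def criticalParameter {V : Type*} (𝒢 : SimpleGraph V) : ℝ :=
  sSup {p : ℝ | ∃ hp : p ∈ unitInterval, ∀ᵐ ω ∂(𝒢.bondPercolation ⟨p, hp⟩),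
    ¬ 𝒢.HasInfiniteCluster ω}

end SimpleGraph

/-! Write `π` for the projection and `H` for the quotient. Exploring a cluster of `H` and testing,
for each explored edge, one lifted edge at a chosen lift of its endpoint already shows that `𝒢`
percolates at least as well as `H`. Strictness comes from the lifts that this procedure ignores. By
`exists_forall_dist_smul_le` they are never far: only finitely many ball-growth functions occur, so
a projection injective on a large enough ball would be injective on every ball with that centre,
against freeness. Hence, for some `r`, each vertex of an `r`-ball of `H` has two lifts joined, above
that ball, to any given lift of its centre (`exists_two_lifts`).

The spare lifts pay for an enhancement of percolation on `H`: a reached vertex that is marked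
(probability `s`), carries the only seed within distance `2 * r + 2`, and has a fully open `r`-ball
also reaches its whole `r + 1`-ball. When such a vertex is reached, the lifted exploration tests
boundedly many edges around its lift and leaves the ball from lifts other than the chosen ones, so
these edges have not been found closed before. All tests succeed with probability at least `s` once
`s ≤ q ^ (k ^ 2)`; thus `𝒢` at parameter `q` reaches at least as far as the enhanced model at `(q,
s)` (`ExplorationState.comparison`, `seedHits_le_coverHits`). The seeds keep tests around different
vertices disjoint.

It remains to see that the enhancement beats a small decrease of the edge parameter, in the manner
of Aizenman and Grimmett. A pivotal edge can be turned into a pivotal mark by a bounded modification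
(`exists_pivotal_mark`), so edge influences are bounded by nearby mark influences
(`link_influence_le`). Russo's formula along `t ↦ (p - κ * t, t)` then gives
`exists_interpolation_rate`. Starting at `p₀` just above the threshold of `H` and ending at `q = p₀
- κ * s` below it, `𝒢` percolates at every parameter above `q`. All comparisons are made for finite
products, and carried to the infinite product through cylinder events. -/

/-! ### Expectations under finite Bernoulli products -/

/-- The expectation of `f` evaluated at the random subset of `S` that contains each `i ∈ S`
independently with probability `p i`. -/
noncomputable def bernoulliExp {ι : Type*} (S : Finset ι) (p : ι → ℝ) (f : Set ι → ℝ) : ℝ :=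
  open Classical in
  ∑ T ∈ S.powerset, (∏ i ∈ T, p i) * (∏ i ∈ S \ T, (1 - p i)) * f ↑T

namespace bernoulliExp

variable {ι : Type*} {S : Finset ι} {p : ι → ℝ} {f g : Set ι → ℝ}

theorem empty : bernoulliExp ∅ p f = f ∅ := by
  simp [bernoulliExp]

open Classical in
theorem insert {i : ι} (hi : i ∉ S) :
    bernoulliExp (insert i S) p f =
      p i * bernoulliExp S p (fun T => f (insert i T)) + (1 - p i) * bernoulliExp S p f := by
  unfold bernoulliExp
  rw [Finset.sum_powerset_insert hi, add_comm, Finset.mul_sum, Finset.mul_sum]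
  congr 1
  · refine Finset.sum_congr rfl fun T hT => ?_
    rw [Finset.mem_powerset] at hT
    have hiT : i ∉ T := fun h => hi (hT h)
    rw [Finset.prod_insert hiT, Finset.insert_sdiff_insert, Finset.sdiff_insert_of_notMem hi,
      Finset.coe_insert]
    ring
  · refine Finset.sum_congr rfl fun T hT => ?_
    rw [Finset.mem_powerset] at hT
    have hiT : i ∉ T := fun h => hi (hT h)
    rw [Finset.insert_sdiff_of_notMem _ hiT, Finset.prod_insert (by simp [hi])]
    ring

theorem congr (h : ∀ T : Set ι, T ⊆ S → f T = g T) :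
    bernoulliExp S p f = bernoulliExp S p g := by
  unfold bernoulliExp
  refine Finset.sum_congr rfl fun T hT => ?_
  rw [h _ (by exact_mod_cast Finset.mem_powerset.1 hT)]

theorem congr_weight {q : ι → ℝ} (h : ∀ i ∈ S, p i = q i) :
    bernoulliExp S p f = bernoulliExp S q f := by
  classical
  unfold bernoulliExp
  refine Finset.sum_congr rfl fun T hT => ?_
  rw [Finset.mem_powerset] at hT
  have h1 : ∏ i ∈ T, p i = ∏ i ∈ T, q i := Finset.prod_congr rfl fun i hi => h i (hT hi)
  have h2 : ∏ i ∈ S \ T, (1 - p i) = ∏ i ∈ S \ T, (1 - q i) :=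
    Finset.prod_congr rfl fun i hi => by rw [h i (Finset.sdiff_subset hi)]
  rw [h1, h2]

theorem sub : bernoulliExp S p (fun T => f T - g T) = bernoulliExp S p f - bernoulliExp S p g := by
  simp [bernoulliExp, mul_sub, Finset.sum_sub_distrib]

theorem sum {κ : Type*} (K : Finset κ) (F : κ → Set ι → ℝ) :
    bernoulliExp S p (fun T => ∑ k ∈ K, F k T) = ∑ k ∈ K, bernoulliExp S p (F k) := by
  simp only [bernoulliExp, Finset.mul_sum]
  exact Finset.sum_comm

theorem mono (h0 : ∀ i ∈ S, 0 ≤ p i) (h1 : ∀ i ∈ S, p i ≤ 1)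
    (h : ∀ T : Set ι, T ⊆ S → f T ≤ g T) :
    bernoulliExp S p f ≤ bernoulliExp S p g := by
  classical
  unfold bernoulliExp
  refine Finset.sum_le_sum fun T hT => ?_
  rw [Finset.mem_powerset] at hT
  refine mul_le_mul_of_nonneg_left (h _ (by exact_mod_cast hT)) (mul_nonneg ?_ ?_)
  · exact Finset.prod_nonneg fun i hi => h0 i (hT hi)
  · exact Finset.prod_nonneg fun i hi => by linarith [h1 i (Finset.sdiff_subset hi)]

theorem const (c : ℝ) : bernoulliExp S p (fun _ => c) = c := by
  classical
  induction S using Finset.induction_on with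
  | empty => exact empty
  | insert i S hi ih => rw [insert hi, ih]; ring

theorem nonneg (h0 : ∀ i ∈ S, 0 ≤ p i) (h1 : ∀ i ∈ S, p i ≤ 1)
    (h : ∀ T : Set ι, T ⊆ S → 0 ≤ f T) : 0 ≤ bernoulliExp S p f := by
  rw [← const (S := S) (p := p) 0]
  exact mono h0 h1 h

/-- Unlike in `insert`, the index stays in `S`: neither integrand on the right sees `i`, so all
expectations can be compared over the same product. -/
theorem cond {i : ι} (hi : i ∈ S) :
    bernoulliExp S p f = p i * bernoulliExp S p (fun T => f (Insert.insert i T)) +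
      (1 - p i) * bernoulliExp S p (fun T => f (T \ {i})) := by
  classical
  obtain ⟨S', hi', rfl⟩ : ∃ S', i ∉ S' ∧ S = Insert.insert i S' :=
    ⟨S.erase i, by simp, by simp [Finset.insert_erase hi]⟩
  have e1 : bernoulliExp S' p (fun T => f (T \ {i})) = bernoulliExp S' p f :=
    congr fun T hT => by
      rw [Set.sdiff_singleton_eq_self]
      exact fun h => hi' (hT h)
  have e2 : bernoulliExp S' p (fun T => f (Insert.insert i T \ {i})) = bernoulliExp S' p f :=
    congr fun T hT => by
      rw [Set.insert_sdiff_of_mem _ (Set.mem_singleton i), Set.sdiff_singleton_eq_self]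
      exact fun h => hi' (hT h)
  rw [insert hi', insert hi', insert hi']
  simp only [Set.insert_idem, e1, e2]
  ring

theorem insert_le (h0 : ∀ i ∈ S, 0 ≤ p i) (h1 : ∀ i ∈ S, p i ≤ 1) (hf : ∀ T, 0 ≤ f T) {i : ι}
    (hi : i ∈ S) : p i * bernoulliExp S p (fun T => f (Insert.insert i T)) ≤ bernoulliExp S p f := by
  rw [cond (f := f) hi]
  have := mul_nonneg (sub_nonneg.2 (h1 i hi))
    (nonneg h0 h1 (f := fun T => f (T \ {i})) fun T _ => hf _)
  linarith

theorem erase_le (h0 : ∀ i ∈ S, 0 ≤ p i) (h1 : ∀ i ∈ S, p i ≤ 1) (hf : ∀ T, 0 ≤ f T) {i : ι}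
    (hi : i ∈ S) : (1 - p i) * bernoulliExp S p (fun T => f (T \ {i})) ≤ bernoulliExp S p f := by
  rw [cond (f := f) hi]
  have := mul_nonneg (h0 i hi)
    (nonneg h0 h1 (f := fun T => f (Insert.insert i T)) fun T _ => hf _)
  linarith

open Classical in
/-- Forcing the configuration on `L` to be `A` costs at most a factor `c ^ #L`. -/
theorem modify_le (h0 : ∀ i ∈ S, 0 ≤ p i) (h1 : ∀ i ∈ S, p i ≤ 1) {c : ℝ} (hc : 0 ≤ c)
    (L : Finset ι) : ∀ (A : Finset ι), A ⊆ L → L ⊆ S → (∀ i ∈ A, c ≤ p i) →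
      (∀ i ∈ L \ A, c ≤ 1 - p i) → ∀ f : Set ι → ℝ, (∀ T, 0 ≤ f T) →
      c ^ L.card * bernoulliExp S p (fun T => f (T \ L ∪ A)) ≤ bernoulliExp S p f := by
  induction L using Finset.induction_on with
  | empty =>
    intro A hA _ _ _ f _
    obtain rfl : A = ∅ := Finset.subset_empty.1 hA
    simp
  | insert i L hi ih =>
    intro A hA hLS hcA hcL f hf
    have hiS : i ∈ S := hLS (Finset.mem_insert_self _ _)
    rw [Finset.card_insert_of_notMem hi]
    have hA' : A.erase i ⊆ L := fun j hj => by
      have := hA (Finset.mem_of_mem_erase hj)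
      rw [Finset.mem_insert] at this
      exact this.resolve_left (Finset.ne_of_mem_erase hj)
    have key := ih (A.erase i) hA' (fun j hj => hLS (Finset.mem_insert_of_mem hj))
      (fun j hj => hcA j (Finset.mem_of_mem_erase hj))
      (fun j hj => hcL j (by
        rw [Finset.mem_sdiff] at hj ⊢
        refine ⟨Finset.mem_insert_of_mem hj.1, fun h => hj.2 ?_⟩
        exact Finset.mem_erase.2 ⟨fun e => hi (e ▸ hj.1), h⟩)) f hf
    have h2 : c * bernoulliExp S p (fun T => f (T \ (Insert.insert i L : Finset ι) ∪ A)) ≤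
        bernoulliExp S p (fun T => f (T \ L ∪ (A.erase i : Finset ι))) := by
      by_cases hiA : i ∈ A
      · have e : (fun T : Set ι => f (T \ (Insert.insert i L : Finset ι) ∪ A)) =
            fun T => (fun T : Set ι => f (T \ L ∪ (A.erase i : Finset ι))) (Insert.insert i T) := by
          funext T
          congr 1
          ext j
          by_cases hj : j = i
          · subst hj; simp [hiA, hi]
          · simp [hj]
        rw [e]
        refine le_trans (mul_le_mul_of_nonneg_right (hcA i hiA)
          (nonneg h0 h1 fun T _ => hf _)) (insert_le (f := fun T : Set ι => f (T \ L ∪ (A.erase i : Finset ι)))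
            h0 h1 (fun T => hf _) hiS)
      · have e : (fun T : Set ι => f (T \ (Insert.insert i L : Finset ι) ∪ A)) =
            fun T => (fun T : Set ι => f (T \ L ∪ (A.erase i : Finset ι))) (T \ {i}) := by
          funext T
          congr 1
          ext j
          by_cases hj : j = i
          · subst hj; simp [hiA]
          · simp [hj]
        rw [e]
        refine le_trans (mul_le_mul_of_nonneg_right (hcL i (by simp [hiA]))
          (nonneg h0 h1 fun T _ => hf _)) (erase_le (f := fun T : Set ι => f (T \ L ∪ (A.erase i : Finset ι)))
            h0 h1 (fun T => hf _) hiS)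
    calc _ = c ^ L.card * (c * bernoulliExp S p
          (fun T => f (T \ (Insert.insert i L : Finset ι) ∪ A))) := by ring
      _ ≤ _ := (mul_le_mul_of_nonneg_left h2 (pow_nonneg hc _)).trans key

/-- For increasing `f`, testing whether all of `F` is present. -/
theorem test_le (h0 : ∀ i ∈ S, 0 ≤ p i) (h1 : ∀ i ∈ S, p i ≤ 1) (q : ℝ) (F : Finset ι) :
    F ⊆ S → (∀ i ∈ F, p i = q) → ∀ f : Set ι → ℝ, Monotone f →
    q ^ F.card * bernoulliExp S p (fun T => f (T ∪ F)) +
      (1 - q ^ F.card) * bernoulliExp S p (fun T => f (T \ F)) ≤ bernoulliExp S p f := by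
  classical
  induction F using Finset.induction_on with
  | empty => intro _ _ f _; simp
  | insert i F hi ih =>
    intro hFS hq f hf
    have hiS : i ∈ S := hFS (Finset.mem_insert_self _ _)
    have hpi : p i = q := hq i (Finset.mem_insert_self _ _)
    have hq0 : 0 ≤ q := hpi ▸ h0 i hiS
    have hq1 : q ≤ 1 := hpi ▸ h1 i hiS
    have hm : Monotone fun T : Set ι => f (Insert.insert i T) :=
      fun A B hAB => hf (Set.insert_subset_insert hAB)
    have key := ih (fun j hj => hFS (Finset.mem_insert_of_mem hj))
      (fun j hj => hq j (Finset.mem_insert_of_mem hj)) _ hm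
    have m1 : bernoulliExp S p (fun T => f (T \ (Insert.insert i F : Finset ι))) ≤
        bernoulliExp S p (fun T => f (Insert.insert i (T \ F))) :=
      mono h0 h1 fun T _ => hf fun j hj => by
        simp at hj ⊢; tauto
    -- Wherever the test fails, removing all of `insert i F` gives a lower bound, by monotonicity;
    -- `m1` covers a failure inside `F` and `m2` a failure at `i`.
    have m2 : bernoulliExp S p (fun T => f (T \ (Insert.insert i F : Finset ι))) ≤
        bernoulliExp S p (fun T => f (T \ {i})) :=
      mono h0 h1 fun T _ => hf fun j hj => by
        simp at hj ⊢; tauto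
    have e : bernoulliExp S p (fun T => f (T ∪ (Insert.insert i F : Finset ι))) =
        bernoulliExp S p (fun T => f (Insert.insert i (T ∪ F))) :=
      congr fun T _ => by congr 1; ext j; simp
    rw [cond (f := f) hiS, hpi, Finset.card_insert_of_notMem hi, e]
    have hk0 : 0 ≤ q ^ F.card := pow_nonneg hq0 _
    have hk1 : q ^ F.card ≤ 1 := pow_le_one₀ hq0 hq1
    have a1 := mul_le_mul_of_nonneg_left key hq0
    have a2 := mul_le_mul_of_nonneg_left m1 (mul_nonneg hq0 (sub_nonneg.2 hk1))
    have a3 := mul_le_mul_of_nonneg_left m2 (sub_nonneg.2 hq1)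
    have e3 : bernoulliExp S p (fun T => f (Insert.insert i (T ∪ F))) =
      bernoulliExp S p (fun T => f (Insert.insert i T ∪ F)) :=
        congr fun T _ => by rw [Set.insert_union]
    rw [e3] at *
    have e4 : bernoulliExp S p (fun T => f (Insert.insert i (T ∪ F))) =
      bernoulliExp S p (fun T => f (Insert.insert i T ∪ F)) :=
        congr fun T _ => by rw [Set.insert_union]
    rw [e4] at a1
    rw [pow_succ]
    nlinarith

open Classical in
/-- Coordinates that the function does not see may be dropped. -/
theorem inter_eq {S' : Finset ι} (h : S' ⊆ S) :
    bernoulliExp S p (fun T => f (T ∩ S')) = bernoulliExp S' p f := by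
  obtain ⟨D, hD, rfl⟩ : ∃ D, Disjoint D S' ∧ S = D ∪ S' :=
    ⟨S \ S', Finset.sdiff_disjoint, by rw [Finset.sdiff_union_of_subset h]⟩
  clear h
  induction D using Finset.induction_on with
  | empty =>
    rw [Finset.empty_union]
    exact congr fun T hT => by rw [Set.inter_eq_left.2 hT]
  | insert i D hi ih =>
    rw [Finset.disjoint_insert_left] at hD
    rw [Finset.insert_union, insert (by simp [hi, hD.1])]
    have : (fun T : Set ι => f (Insert.insert i T ∩ S')) = fun T => f (T ∩ S') := by
      funext T
      rw [Set.insert_inter_of_notMem (by simpa using hD.1)]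
    rw [this, ih hD.2]
    ring

open Classical in
/-- A bound that holds conditionally on the configuration in `B` holds unconditionally. -/
theorem le_of_forall_union {c : ℝ} {S B : Finset ι} (hB : Disjoint B S)
    (h0 : ∀ i ∈ B, 0 ≤ p i) (h1 : ∀ i ∈ B, p i ≤ 1)
    (h : ∀ A : Finset ι, A ⊆ B → bernoulliExp S p (fun T => f (T ∪ A)) ≤ c) :
    bernoulliExp (B ∪ S) p f ≤ c := by
  induction B using Finset.induction_on generalizing f with
  | empty => simpa using h ∅ subset_rfl
  | insert i B hi ih =>
    rw [Finset.disjoint_insert_left] at hB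
    rw [Finset.insert_union, insert (by simp [hi, hB.1])]
    have hi0 := h0 i (Finset.mem_insert_self _ _)
    have hi1 := h1 i (Finset.mem_insert_self _ _)
    have k1 := ih (f := fun T => f (Insert.insert i T)) hB.2
      (fun j hj => h0 j (Finset.mem_insert_of_mem hj))
      (fun j hj => h1 j (Finset.mem_insert_of_mem hj)) fun A hA => by
        have := h (Insert.insert i A) (Finset.insert_subset_insert _ hA)
        refine le_of_eq_of_le (congr fun T _ => ?_) this
        congr 1; ext j; simp
    have k2 := ih (f := f) hB.2 (fun j hj => h0 j (Finset.mem_insert_of_mem hj))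
      (fun j hj => h1 j (Finset.mem_insert_of_mem hj)) fun A hA =>
        h A (hA.trans (Finset.subset_insert _ _))
    nlinarith

theorem mono_weight {q : ι → ℝ} (h0 : ∀ i ∈ S, 0 ≤ p i) (h1 : ∀ i ∈ S, q i ≤ 1)
    (hpq : ∀ i ∈ S, p i ≤ q i) (hf : Monotone f) :
    bernoulliExp S p f ≤ bernoulliExp S q f := by
  classical
  induction S using Finset.induction_on generalizing f with
  | empty => rw [empty, empty]
  | insert i S hi ih =>
    have hS : ∀ j ∈ S, j ∈ Insert.insert i S := fun j hj => Finset.mem_insert_of_mem hj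
    have hii := Finset.mem_insert_self i S
    have k1 := ih (f := fun T => f (Insert.insert i T)) (fun j hj => h0 j (hS j hj))
      (fun j hj => h1 j (hS j hj)) (fun j hj => hpq j (hS j hj))
      (fun A B hAB => hf (Set.insert_subset_insert hAB))
    have k2 := ih (f := f) (fun j hj => h0 j (hS j hj))
      (fun j hj => h1 j (hS j hj)) (fun j hj => hpq j (hS j hj)) hf
    have k3 : bernoulliExp S p f ≤ bernoulliExp S p fun T => f (Insert.insert i T) :=
      mono (fun j hj => h0 j (hS j hj)) (fun j hj => (hpq j (hS j hj)).trans (h1 j (hS j hj)))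
        fun T _ => hf (Set.subset_insert _ _)
    rw [insert hi, insert hi]
    have := hpq i hii
    have := h1 i hii
    have := h0 i hii
    nlinarith

/-- Russo's formula. -/
theorem hasDerivAt {w : ι → ℝ → ℝ} {w' : ι → ℝ} {t : ℝ} (hw : ∀ i ∈ S, HasDerivAt (w i) (w' i) t)
    (f : Set ι → ℝ) :
    HasDerivAt (fun t => bernoulliExp S (fun i => w i t) f)
      (∑ i ∈ S, w' i * bernoulliExp S (fun i => w i t)
        (fun T => f (Insert.insert i T) - f (T \ {i}))) t := by
  classical
  induction S using Finset.induction_on generalizing f with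
  | empty => simpa [empty] using hasDerivAt_const t (f ∅)
  | insert i S hi ih =>
    have hS : ∀ j ∈ S, j ∈ Insert.insert i S := fun j hj => Finset.mem_insert_of_mem hj
    have k1 := ih (fun j hj => hw j (hS j hj)) (fun T => f (Insert.insert i T))
    have k2 := ih (fun j hj => hw j (hS j hj)) f
    have hi' := hw i (Finset.mem_insert_self _ _)
    -- Splitting off `i` makes the expectation a combination affine in `w i t`. The product rule
    -- yields the influence of `i`, and the inductive derivatives recombine into the other
    -- influences.
    have k := (hi'.mul k1).add ((hi'.const_sub 1).mul k2)
    have efun : (fun t => bernoulliExp (Insert.insert i S) (fun i => w i t) f) =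
        (w i * fun t => bernoulliExp S (fun i => w i t) (fun T => f (Insert.insert i T))) +
        ((fun t => 1 - w i t) * fun t => bernoulliExp S (fun i => w i t) f) := by
      funext t
      simp [insert hi]
    rw [efun]
    refine k.congr_deriv (Eq.symm ?_)
    rw [Finset.sum_insert hi]
    have e1 : bernoulliExp (Insert.insert i S) (fun i => w i t)
        (fun T => f (Insert.insert i T) - f (T \ {i})) =
        bernoulliExp S (fun i => w i t) (fun T => f (Insert.insert i T)) -
        bernoulliExp S (fun i => w i t) f := by
      rw [insert hi, ← sub]
      have : ∀ T : Set ι, T ⊆ S → T \ {i} = T := fun T hT =>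
        Set.sdiff_singleton_eq_self fun h => hi (hT h)
      rw [congr (g := fun T => f (Insert.insert i T) - f T) fun T hT => by
        rw [Set.insert_idem, Set.insert_sdiff_of_mem _ (Set.mem_singleton i), this T hT],
        congr (f := fun T => f (Insert.insert i T) - f (T \ {i}))
          (g := fun T => f (Insert.insert i T) - f T) fun T hT => by rw [this T hT]]
      ring
    have e2 : ∀ j ∈ S, bernoulliExp (Insert.insert i S) (fun i => w i t)
        (fun T => f (Insert.insert j T) - f (T \ {j})) =
        w i t * bernoulliExp S (fun i => w i t)
          (fun T => f (Insert.insert i (Insert.insert j T)) - f (Insert.insert i (T \ {j}))) +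
        (1 - w i t) * bernoulliExp S (fun i => w i t)
          (fun T => f (Insert.insert j T) - f (T \ {j})) := by
      intro j hj
      have hij : i ≠ j := fun h => hi (h ▸ hj)
      rw [insert hi]
      congr 2
      refine congr fun T _ => ?_
      rw [Set.insert_comm, Set.insert_sdiff_of_notMem _ (by simpa using hij)]
    rw [e1, Finset.sum_congr rfl fun j hj => by rw [e2 j hj]]
    simp only [mul_add, Finset.sum_add_distrib, Finset.mul_sum]
    rw [Finset.sum_congr rfl fun j _ => mul_left_comm (w' j) (w i t) _,
      Finset.sum_congr rfl fun j _ => mul_left_comm (w' j) (1 - w i t) _]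
    ring

end bernoulliExp

namespace SimpleGraph

/-! ### Balls for the graph distance -/

section Balls

variable {V : Type*} {G : SimpleGraph V}

/-- The closed ball for the graph distance. -/
def distBall (G : SimpleGraph V) (x : V) (n : ℕ) : Set V := {y | G.dist x y ≤ n}

theorem Connected.exists_adj_of_dist_succ (hG : G.Connected) {x y : V} {n : ℕ}
    (h : G.dist x y = n + 1) : ∃ z, G.Adj z y ∧ G.dist x z = n := by
  obtain ⟨w, hw⟩ := (hG y x).exists_walk_length_eq_dist
  rw [dist_comm, h] at hw
  cases w with
  | nil => simp at hw
  | @cons _ z _ hyz w =>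
    refine ⟨z, hyz.symm, ?_⟩
    rw [Walk.length_cons] at hw
    have h1 : G.dist x z ≤ n := by
      rw [dist_comm]
      exact (dist_le w).trans (by omega)
    have h2 : G.dist x y ≤ G.dist x z + G.dist z y := hG.dist_triangle
    rw [dist_eq_one_iff_adj.2 hyz.symm] at h2
    omega

theorem Connected.dist_le_succ (hG : G.Connected) {x y z : V} (h : G.Adj y z) :
    G.dist x z ≤ G.dist x y + 1 := by
  have := hG.dist_triangle (u := x) (v := y) (w := z)
  rwa [dist_eq_one_iff_adj.2 h] at this

theorem Connected.finite_distBall (hG : G.Connected) (hlf : ∀ v, (G.neighborSet v).Finite)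
    (x : V) (n : ℕ) : (G.distBall x n).Finite := by
  induction n with
  | zero =>
    refine (Set.finite_singleton x).subset fun y hy => ?_
    have : G.dist x y = 0 := Nat.le_zero.1 hy
    exact ((hG x y).dist_eq_zero_iff.1 this).symm
  | succ n ih =>
    refine (ih.union (ih.biUnion fun y _ => hlf y)).subset fun z hz => ?_
    rcases Nat.lt_or_ge n (G.dist x z) with h | h
    · obtain ⟨y, hyz, hy⟩ := hG.exists_adj_of_dist_succ (x := x) (y := z) (n := n)
        (le_antisymm hz h)
      exact Or.inr (Set.mem_biUnion (show y ∈ G.distBall x n from hy.le) hyz)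
    · exact Or.inl h

theorem Connected.countable (hG : G.Connected) (hlf : ∀ v, (G.neighborSet v).Finite) :
    Countable V := by
  obtain ⟨x⟩ := hG.nonempty
  rw [← Set.countable_univ_iff]
  refine (Set.countable_iUnion fun n => (hG.finite_distBall hlf x n).countable).mono fun y _ => ?_
  exact Set.mem_iUnion.2 ⟨G.dist x y, le_refl (G.dist x y)⟩

theorem dist_map_le {W : Type*} {H : SimpleGraph W} (hG : G.Connected) (hH : H.Connected)
    {f : V → W} (hf : ∀ x y, G.Adj x y → f x = f y ∨ H.Adj (f x) (f y)) (x y : V) :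
    H.dist (f x) (f y) ≤ G.dist x y := by
  obtain ⟨n, hn⟩ : ∃ n, G.dist x y = n := ⟨_, rfl⟩
  induction n generalizing y with
  | zero => rw [(hG x y).dist_eq_zero_iff.1 hn]; simp
  | succ n ih =>
    obtain ⟨z, hzy, hz⟩ := hG.exists_adj_of_dist_succ hn
    have := ih z hz
    rcases hf z y hzy with h | h
    · rw [← h]; omega
    · have := hH.dist_le_succ (x := f x) h
      omega

theorem Iso.dist_map (hG : G.Connected) (φ : G ≃g G) (x y : V) :
    G.dist (φ x) (φ y) = G.dist x y := by
  refine le_antisymm (dist_map_le hG hG (fun a b h => Or.inr (φ.map_adj_iff.2 h)) x y) ?_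
  have := dist_map_le hG hG (f := φ.symm)
    (fun a b h => Or.inr (φ.symm.map_adj_iff.2 h)) (φ x) (φ y)
  simpa using this

theorem IsQuasiTransitive.finite_range (hG : G.IsQuasiTransitive) {α : Type*} (f : V → α)
    (hf : ∀ (φ : G ≃g G) (x : V), f (φ x) = f x) : (Set.range f).Finite := by
  have : Finite (MulAction.orbitRel.Quotient (G ≃g G) V) := hG
  let F : MulAction.orbitRel.Quotient (G ≃g G) V → α := Quotient.lift f (by
    rintro a b ⟨φ, rfl⟩
    exact hf φ b)
  refine (Set.finite_range F).subset ?_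
  rintro _ ⟨x, rfl⟩
  exact ⟨Quotient.mk _ x, rfl⟩

/-- The number of points of the balls around a vertex. -/
noncomputable def growth (G : SimpleGraph V) (x : V) : ℕ → ℕ := fun n => (G.distBall x n).ncard

theorem Iso.growth_map (hG : G.Connected) (φ : G ≃g G) (x : V) : G.growth (φ x) = G.growth x := by
  funext n
  have : G.distBall (φ x) n = φ '' G.distBall x n := by
    ext y
    constructor
    · intro hy
      refine ⟨φ.symm y, ?_, by simp⟩
      have := φ.dist_map hG x (φ.symm y)
      simp only [RelIso.apply_symm_apply] at this
      exact this.symm.trans_le hy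
    · rintro ⟨z, hz, rfl⟩
      exact (φ.dist_map hG x z).trans_le hz
  rw [growth, growth, this, Set.ncard_image_of_injective _ φ.injective]

theorem IsQuasiTransitive.finite_range_growth (hq : G.IsQuasiTransitive) (hG : G.Connected) :
    (Set.range G.growth).Finite :=
  hq.finite_range _ fun φ x => φ.growth_map hG x

theorem IsQuasiTransitive.exists_ncard_distBall_le (hq : G.IsQuasiTransitive) (hG : G.Connected)
    (n : ℕ) : ∃ k, ∀ x, (G.distBall x n).ncard ≤ k := by
  obtain ⟨k, hk⟩ := ((hq.finite_range_growth hG).image fun f => f n).bddAbove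
  exact ⟨k, fun x => hk ⟨_, ⟨x, rfl⟩, rfl⟩⟩

end Balls

/-! ### Lifting through a quotient -/

section Lifting

variable {V W : Type*} {G : SimpleGraph V} {H : SimpleGraph W} {π : V → W}

/-- A geodesic below is lifted edge by edge, starting from the given point. -/
theorem exists_lift_dist_le (hG : G.Connected) (hH : H.Connected)
    (hlift : ∀ x v, H.Adj (π x) v → ∃ y, G.Adj x y ∧ π y = v) (x : V) (w : W) :
    ∃ y, π y = w ∧ G.dist x y ≤ H.dist (π x) w := by
  obtain ⟨n, hn⟩ : ∃ n, H.dist (π x) w = n := ⟨_, rfl⟩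
  induction n generalizing w with
  | zero => exact ⟨x, (hH _ _).dist_eq_zero_iff.1 hn, by simp⟩
  | succ n ih =>
    obtain ⟨z, hzw, hz⟩ := hH.exists_adj_of_dist_succ hn
    obtain ⟨y, rfl, hy⟩ := ih z hz
    obtain ⟨y', hyy', rfl⟩ := hlift y w hzw
    refine ⟨y', rfl, ?_⟩
    have := hG.dist_le_succ (x := x) hyy'
    omega

theorem image_distBall (hG : G.Connected) (hH : H.Connected)
    (hadj : ∀ x y, G.Adj x y → π x = π y ∨ H.Adj (π x) (π y))
    (hlift : ∀ x v, H.Adj (π x) v → ∃ y, G.Adj x y ∧ π y = v) (x : V) (n : ℕ) :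
    π '' G.distBall x n = H.distBall (π x) n := by
  ext w
  constructor
  · rintro ⟨y, hy, rfl⟩
    exact (dist_map_le hG hH hadj x y).trans hy
  · intro hw
    obtain ⟨y, rfl, hy⟩ := exists_lift_dist_le hG hH hlift x w
    exact ⟨y, hy.trans hw, rfl⟩

/-- Within a ball, every point is joined to the centre. -/
theorem Connected.reflTransGen_distBall (hG : G.Connected) {x y : V} {n : ℕ}
    (h : G.dist x y ≤ n) :
    Relation.ReflTransGen (fun a b => G.Adj a b ∧ G.dist x a ≤ n ∧ G.dist x b ≤ n) x y := by
  obtain ⟨m, hm⟩ : ∃ m, G.dist x y = m := ⟨_, rfl⟩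
  induction m generalizing y with
  | zero => rw [(hG x y).dist_eq_zero_iff.1 hm]
  | succ m ih =>
    obtain ⟨z, hzy, hz⟩ := hG.exists_adj_of_dist_succ hm
    exact (ih (by omega) hz).tail ⟨hzy, by omega, h⟩

end Lifting

/-! ### Quotients by free actions -/

section Quotient

variable {V : Type*} {G : SimpleGraph V} {Γ : Type*} [Group Γ] [MulAction Γ V]

/-- The projection onto the quotient. -/
abbrev orbitProj (Γ : Type*) {V : Type*} [Group Γ] [MulAction Γ V] (x : V) :
    MulAction.orbitRel.Quotient Γ V :=
  Quotient.mk _ x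

theorem orbitProj_eq_iff {x y : V} : orbitProj Γ x = orbitProj Γ y ↔ ∃ g : Γ, g • y = x := by
  rw [Quotient.eq]
  exact Iff.rfl

theorem orbitProj_smul (g : Γ) (x : V) : orbitProj Γ (g • x) = orbitProj Γ x :=
  orbitProj_eq_iff.2 ⟨g, rfl⟩

theorem orbitProj_adj {x y : V} (h : G.Adj x y) :
    orbitProj Γ x = orbitProj Γ y ∨ (G.orbitQuotient Γ).Adj (orbitProj Γ x) (orbitProj Γ y) := by
  by_cases e : orbitProj Γ x = orbitProj Γ y
  · exact Or.inl e
  · exact Or.inr ⟨e, x, y, rfl, rfl, h⟩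

/-- Some edge joins the two orbits; a group element moves its first endpoint to the prescribed `x`.
-/
theorem orbitProj_lift (haut : ∀ (g : Γ) (x y : V), G.Adj (g • x) (g • y) ↔ G.Adj x y)
    (x : V) (v : MulAction.orbitRel.Quotient Γ V)
    (h : (G.orbitQuotient Γ).Adj (orbitProj Γ x) v) : ∃ y, G.Adj x y ∧ orbitProj Γ y = v := by
  obtain ⟨_, x', y', hx, rfl, hxy⟩ := h
  obtain ⟨g, rfl⟩ := orbitProj_eq_iff.1 hx.symm
  exact ⟨g • y', (haut g _ _).2 hxy, orbitProj_smul g y'⟩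

theorem Connected.orbitQuotient (hG : G.Connected) : (G.orbitQuotient Γ).Connected := by
  have hne : Nonempty (MulAction.orbitRel.Quotient Γ V) := hG.nonempty.map (orbitProj Γ)
  refine Connected.mk fun a b => ?_
  induction a using Quotient.inductionOn with | h x => ?_
  induction b using Quotient.inductionOn with | h y => ?_
  obtain ⟨w⟩ := hG x y
  induction w with
  | nil => exact Reachable.refl _
  | cons h _ ih =>
    rcases orbitProj_adj (Γ := Γ) h with e | e
    · change (G.orbitQuotient Γ).Reachable (orbitProj Γ _) _
      rw [e]
      exact ih
    · exact e.reachable.trans ih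

theorem orbitQuotient_neighborSet_finite
    (haut : ∀ (g : Γ) (x y : V), G.Adj (g • x) (g • y) ↔ G.Adj x y)
    (hlf : ∀ v, (G.neighborSet v).Finite) (w : MulAction.orbitRel.Quotient Γ V) :
    ((G.orbitQuotient Γ).neighborSet w).Finite := by
  induction w using Quotient.inductionOn with | h x => ?_
  refine ((hlf x).image (orbitProj Γ)).subset fun v hv => ?_
  obtain ⟨y, hy, rfl⟩ := orbitProj_lift haut x v hv
  exact ⟨y, hy, rfl⟩

theorem dist_smul (hG : G.Connected)
    (haut : ∀ (g : Γ) (x y : V), G.Adj (g • x) (g • y) ↔ G.Adj x y) (g : Γ) (x y : V) :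
    G.dist (g • x) (g • y) = G.dist x y :=
  Iso.dist_map hG (⟨MulAction.toPerm g, haut g _ _⟩ : G ≃g G) x y

/-- The fibres of the projection have uniformly bounded gaps. -/
theorem exists_forall_dist_smul_le [Nontrivial Γ] (hG : G.Connected)
    (hlf : ∀ v, (G.neighborSet v).Finite)
    (haut : ∀ (g : Γ) (x y : V), G.Adj (g • x) (g • y) ↔ G.Adj x y)
    (hfree : ∀ g : Γ, g ≠ 1 → ∀ x : V, g • x ≠ x)
    (hq : G.IsQuasiTransitive) (hq' : (G.orbitQuotient Γ).IsQuasiTransitive) :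
    ∃ R, ∀ x : V, ∃ g : Γ, g ≠ 1 ∧ G.dist x (g • x) ≤ R := by
  set H := G.orbitQuotient Γ with hHdef
  have hH : H.Connected := hG.orbitQuotient
  have hQ := (hq.finite_range_growth hG).union (hq'.finite_range_growth hH)
  -- Quasi-transitivity of both graphs enters here: among finitely many growth functions, distinct
  -- ones already differ below a common `N`.
  obtain ⟨N, hN⟩ : ∃ N, ∀ ab ∈ (Set.range G.growth ∪ Set.range H.growth) ×ˢ
      (Set.range G.growth ∪ Set.range H.growth),
      (∀ k ≤ N, ab.1 k = ab.2 k) → ab.1 = ab.2 := by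
    refine Filter.Eventually.exists (f := Filter.atTop)
      ((Filter.eventually_all_finite (hQ.prod hQ)).2 fun ab _ => ?_)
    by_cases e : ab.1 = ab.2
    · exact Filter.Eventually.of_forall fun _ _ => e
    · obtain ⟨n, hn⟩ := Function.ne_iff.1 e
      filter_upwards [Filter.eventually_ge_atTop n] with N hN h
      exact absurd (h n hN) hn
  refine ⟨2 * N, fun x => ?_⟩
  have himg := image_distBall hG hH (fun a b => orbitProj_adj (Γ := Γ)) (orbitProj_lift haut) x
  have hinj : ¬ Set.InjOn (orbitProj Γ) (G.distBall x N) := by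
    intro hinj
    have heq : G.growth x = H.growth (orbitProj Γ x) := by
      refine hN (G.growth x, H.growth (orbitProj Γ x))
        ⟨Or.inl ⟨x, rfl⟩, Or.inr ⟨_, rfl⟩⟩ fun k hk => ?_
      change (G.distBall x k).ncard = (H.distBall (orbitProj Γ x) k).ncard
      rw [← himg k, Set.InjOn.ncard_image]
      exact hinj.mono fun y hy => le_trans hy hk
    -- Equal finite cardinalities make the projection injective on the ball of radius `dist x (g •
    -- x)`, which contains two points of the same orbit.
    obtain ⟨g, hg⟩ := exists_ne (1 : Γ)
    have h2 := congrFun heq (G.dist x (g • x))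
    rw [growth, growth, ← himg] at h2
    have h3 := (Set.ncard_image_iff (hG.finite_distBall hlf _ _)).1 h2.symm
    refine hfree g hg x (h3 (show G.dist x (g • x) ≤ _ from le_rfl) ?_ (orbitProj_smul g x))
    simp [distBall]
  simp only [Set.InjOn, not_forall] at hinj
  obtain ⟨b, hb, a, ha, hab, hne⟩ := hinj
  obtain ⟨g, rfl⟩ := orbitProj_eq_iff.1 hab
  refine ⟨g, fun h => hne (by simp [h]), ?_⟩
  -- The collision of `a` and `g • a` need not involve the centre; translating by `g` compares `x`
  -- with `g • x` at the cost of two radii.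
  have h1 := hG.dist_triangle (u := x) (v := g • a) (w := g • x)
  rw [dist_smul hG haut, G.dist_comm (u := a)] at h1
  have h2 : G.dist x (g • a) ≤ N := hb
  have h3 : G.dist x a ≤ N := ha
  omega

/-- Every vertex of the `r`-ball below has two lifts which are joined to the centre above
the ball. -/
theorem exists_two_lifts (hG : G.Connected)
    (haut : ∀ (g : Γ) (x y : V), G.Adj (g • x) (g • y) ↔ G.Adj x y)
    (hfree : ∀ g : Γ, g ≠ 1 → ∀ x : V, g • x ≠ x) {r : ℕ}
    (hr : ∀ x : V, ∃ g : Γ, g ≠ 1 ∧ G.dist x (g • x) ≤ r) (x : V)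
    (w : MulAction.orbitRel.Quotient Γ V) (hw : (G.orbitQuotient Γ).dist (orbitProj Γ x) w ≤ r) :
    ∃ w₁ w₂, w₁ ≠ w₂ ∧ ∀ w' ∈ ({w₁, w₂} : Set V), orbitProj Γ w' = w ∧
      Relation.ReflTransGen (fun a b => G.Adj a b ∧
        ((G.orbitQuotient Γ).dist (orbitProj Γ x) (orbitProj Γ a) ≤ r ∧ G.dist x a ≤ 2 * r) ∧
        ((G.orbitQuotient Γ).dist (orbitProj Γ x) (orbitProj Γ b) ≤ r ∧ G.dist x b ≤ 2 * r))
        x w' := by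
  have hH : (G.orbitQuotient Γ).Connected := hG.orbitQuotient
  have hd := dist_map_le hG hH fun a b => orbitProj_adj (Γ := Γ)
  obtain ⟨w₁, hw₁, hd₁⟩ := exists_lift_dist_le hG hH (orbitProj_lift haut) x w
  obtain ⟨g, hg, hgx⟩ := hr x
  have p1 : ∀ y, G.dist x y ≤ r → Relation.ReflTransGen (fun a b => G.Adj a b ∧
        ((G.orbitQuotient Γ).dist (orbitProj Γ x) (orbitProj Γ a) ≤ r ∧ G.dist x a ≤ 2 * r) ∧
        ((G.orbitQuotient Γ).dist (orbitProj Γ x) (orbitProj Γ b) ≤ r ∧ G.dist x b ≤ 2 * r))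
        x y := fun y hy =>
    Relation.ReflTransGen.mono (fun a b hab => ⟨hab.1, ⟨(hd x a).trans hab.2.1, by omega⟩,
      ⟨(hd x b).trans hab.2.2, by omega⟩⟩) _ _ (hG.reflTransGen_distBall hy)
  have p2 : ∀ a, G.dist (g • x) a ≤ r →
      (G.orbitQuotient Γ).dist (orbitProj Γ x) (orbitProj Γ a) ≤ r ∧ G.dist x a ≤ 2 * r := by
    intro a ha
    constructor
    · rw [← orbitProj_smul g x]
      exact (hd _ a).trans ha
    · have := hG.dist_triangle (u := x) (v := g • x) (w := a)
      omega
  -- The second lift is reached through `g • x`. The ball around it has the same projected centre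
  -- and lies within `2 * r` of `x`.
  refine ⟨w₁, g • w₁, (hfree g hg w₁).symm, ?_⟩
  rintro w' (rfl | rfl)
  · exact ⟨hw₁, p1 _ (hd₁.trans hw)⟩
  · refine ⟨(orbitProj_smul g w₁).trans hw₁, (p1 _ hgx).trans ?_⟩
    refine Relation.ReflTransGen.mono (fun a b hab => ⟨hab.1, p2 a hab.2.1, p2 b hab.2.2⟩) _ _
      (hG.reflTransGen_distBall (x := g • x) ?_)
    rw [dist_smul hG haut]
    exact hd₁.trans hw

end Quotient

end SimpleGraph

/-! ### The enhanced percolation model -/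

/-- The coordinates of the enhanced model: edges, marks on vertices, and seeds on vertices. -/
inductive PercItem (W : Type*)
  | link (e : Sym2 W)
  | mark (u : W)
  | seed (u : W)

/-! ### Decomposition of paths at exits, entries and hitting points -/

namespace Relation

variable {α : Type*} {R R' Q : α → α → Prop} {P : α → Prop}

theorem ReflTransGen.exists_first_exit (h : ∀ x y, R x y → R' x y ∨ Q x y) {a b : α}
    (hab : ReflTransGen R a b) (hn : ¬ ReflTransGen R' a b) :
    ∃ x y, ReflTransGen R' a x ∧ Q x y := by
  induction hab with
  | refl => exact absurd .refl hn
  | @tail c d _ hcd ih =>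
    by_cases hc : ReflTransGen R' a c
    · exact ⟨c, d, hc, (h c d hcd).resolve_left fun h' => hn (hc.tail h')⟩
    · exact ih hc

theorem ReflTransGen.exists_last_entry (h : ∀ x y, R x y → R' x y ∨ Q x y) {a b : α}
    (hab : ReflTransGen R a b) (hn : ¬ ReflTransGen R' a b) :
    ∃ x y, Q x y ∧ ReflTransGen R' y b := by
  induction hab using ReflTransGen.head_induction_on with
  | refl => exact absurd .refl hn
  | @head c d hcd _ ih =>
    by_cases hc : ReflTransGen R' d b
    · exact ⟨c, d, (h c d hcd).resolve_left fun h' => hn (hc.head h'), hc⟩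
    · exact ih hc

theorem ReflTransGen.exists_first_hit {a b : α} (hab : ReflTransGen R a b) (hb : P b) :
    ∃ c, P c ∧ ReflTransGen (fun x y => R x y ∧ ¬ P x) a c := by
  induction hab using ReflTransGen.head_induction_on with
  | refl => exact ⟨b, hb, .refl⟩
  | @head x y hxy _ ih =>
    by_cases hx : P x
    · exact ⟨x, hx, .refl⟩
    · obtain ⟨c, hc, hyc⟩ := ih
      exact ⟨c, hc, hyc.head ⟨hxy, hx⟩⟩

theorem ReflTransGen.closed {S : Set α} (hS : ∀ x y, x ∈ S → R x y → y ∈ S) {a b : α}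
    (hab : ReflTransGen R a b) (ha : a ∈ S) : b ∈ S := by
  induction hab with
  | refl => exact ha
  | tail _ hcd ih => exact hS _ _ ih hcd

end Relation

namespace SimpleGraph

open PercItem Relation

variable {W : Type*} (H : SimpleGraph W) (r : ℕ)

/-- A vertex is eligible if it carries the only seed in a neighbourhood. -/
def IsEligible (T : Set (PercItem W)) (u : W) : Prop :=
  seed u ∈ T ∧ ∀ u', u' ≠ u → H.dist u u' ≤ 2 * r + 2 → seed u' ∉ T

/-- All edges of the `r`-ball around `u` are open. -/
def BallOpen (T : Set (PercItem W)) (u : W) : Prop :=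
  ∀ x y, H.Adj x y → H.dist u x ≤ r → H.dist u y ≤ r → link s(x, y) ∈ T

/-- One step of the exploration: either along an open edge, or from a marked vertex of `N` with an
open `r`-ball to any vertex of its `r + 1`-ball. -/
def EnhArc (N : Set W) (T : Set (PercItem W)) (u v : W) : Prop :=
  (H.Adj u v ∧ link s(u, v) ∈ T) ∨
    (u ∈ N ∧ mark u ∈ T ∧ H.BallOpen r T u ∧ H.dist u v ≤ r + 1)

/-- The exploration from `o`, enhanced at the vertices of `N`, reaches distance `n`. -/
def EnhHits (N : Set W) (o : W) (n : ℕ) (T : Set (PercItem W)) : Prop :=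
  ∃ v, n ≤ H.dist o v ∧ ReflTransGen (H.EnhArc r N T) o v

/-- The exploration from `o`, enhanced at the eligible vertices, reaches distance `n`. -/
def SeedHits (o : W) (n : ℕ) (T : Set (PercItem W)) : Prop :=
  H.EnhHits r {u | H.IsEligible r T u} o n T

/-- The items near `o`. -/
def itemBox (o : W) (n : ℕ) : Set (PercItem W) :=
  {i | (∃ x y, i = link s(x, y) ∧ H.Adj x y ∧ H.dist o x ≤ n ∧ H.dist o y ≤ n) ∨
    (∃ u, i = mark u ∧ H.dist o u ≤ n) ∨ ∃ u, i = seed u ∧ H.dist o u ≤ n}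

/-- The marks that are turned off around `a`. -/
def markBox (a : W) : Set (PercItem W) := {i | ∃ u, i = mark u ∧ H.dist a u ≤ 4 * r + 5}

/-- The edges and seeds that are resampled around `a`. -/
def modBox (a : W) : Set (PercItem W) :=
  {i | (∃ x y, i = link s(x, y) ∧ H.Adj x y ∧ H.dist a x ≤ r) ∨
    ∃ u, i = seed u ∧ H.dist a u ≤ 2 * r + 2}

variable {H r} {o a b : W} {n m : ℕ} {T T' : Set (PercItem W)}

theorem BallOpen.mono {u : W} (h : H.BallOpen r T u)
    (hT : ∀ e, link e ∈ T → link e ∈ T') : H.BallOpen r T' u :=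
  fun x y hxy hx hy => hT _ (h x y hxy hx hy)

theorem EnhArc.mono {N N' : Set W} {u v : W} (h : H.EnhArc r N T u v)
    (he : ∀ e, link e ∈ T → link e ∈ T')
    (hm : u ∈ N → mark u ∈ T → u ∈ N' ∧ mark u ∈ T') : H.EnhArc r N' T' u v := by
  rcases h with ⟨h1, h2⟩ | ⟨h1, h2, h3, h4⟩
  · exact Or.inl ⟨h1, he _ h2⟩
  · exact Or.inr ⟨(hm h1 h2).1, (hm h1 h2).2, h3.mono he, h4⟩

/-- The event increases with edges and marks. An additional seed could destroy eligibility, hence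
the condition `hs`. -/
theorem SeedHits.mono (h : H.SeedHits r o n T) (hT : T ⊆ T')
    (hs : ∀ u, seed u ∈ T' → seed u ∈ T) : H.SeedHits r o n T' := by
  obtain ⟨v, hv, hov⟩ := h
  refine ⟨v, hv, ReflTransGen.mono (fun x y hxy => hxy.mono (fun e he => hT he) ?_) _ _ hov⟩
  exact fun hx hm => ⟨⟨hT hx.1, fun u' h1 h2 h3 => hx.2 u' h1 h2 (hs _ h3)⟩, hT hm⟩

/-- Stop at the first vertex at distance at least `m`. Each arc before it starts closer than `m`, so
its edge or its `r`-ball lies in the box; forgetting seeds outside can only help eligibility. -/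
theorem SeedHits.inter_itemBox (hH : H.Connected) (h : H.SeedHits r o n T) (hm : m ≤ n) {l : ℕ}
    (hl : m + r ≤ l) : H.SeedHits r o m (T ∩ H.itemBox o l) := by
  obtain ⟨v, hv, hov⟩ := h
  obtain ⟨c, hc, hoc⟩ := hov.exists_first_hit (P := fun v => m ≤ H.dist o v) (hm.trans hv)
  refine ⟨c, hc, ReflTransGen.mono (fun x y hxy => ?_) _ _ hoc⟩
  obtain ⟨hxy, hx⟩ := hxy
  rcases hxy with ⟨h1, h2⟩ | ⟨h1, h2, h3, h4⟩
  · have := hH.dist_le_succ (x := o) h1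
    exact Or.inl ⟨h1, h2, Or.inl ⟨x, y, rfl, h1, by omega, by omega⟩⟩
  · have hxl : H.dist o x ≤ l := by omega
    refine Or.inr ⟨⟨⟨h1.1, Or.inr (Or.inr ⟨x, rfl, hxl⟩)⟩,
      fun u' e1 e2 e3 => h1.2 u' e1 e2 e3.1⟩, ⟨h2, Or.inr (Or.inl ⟨x, rfl, hxl⟩)⟩, ?_, h4⟩
    intro y z hyz hy hz
    have ty := hH.dist_triangle (u := o) (v := x) (w := y)
    have tz := hH.dist_triangle (u := o) (v := x) (w := z)
    exact ⟨h3 y z hyz hy hz, Or.inl ⟨y, z, rfl, hyz, by omega, by omega⟩⟩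

theorem link_mem_modBox_iff {x y : W} :
    link s(x, y) ∈ H.modBox r a ↔ H.Adj x y ∧ (H.dist a x ≤ r ∨ H.dist a y ≤ r) := by
  constructor
  · rintro (⟨x', y', h, hxy, hx⟩ | ⟨u, h, _⟩)
    · injection h with h
      rcases Sym2.eq_iff.1 h with ⟨rfl, rfl⟩ | ⟨rfl, rfl⟩
      · exact ⟨hxy, Or.inl hx⟩
      · exact ⟨hxy.symm, Or.inr hx⟩
    · cases h
  · rintro ⟨hxy, hx | hy⟩
    · exact Or.inl ⟨x, y, rfl, hxy, hx⟩
    · exact Or.inl ⟨y, x, by rw [Sym2.eq_swap], hxy.symm, hy⟩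

theorem seed_mem_modBox_iff {u : W} : seed u ∈ H.modBox r a ↔ H.dist a u ≤ 2 * r + 2 := by
  constructor
  · rintro (⟨_, _, h, _⟩ | ⟨u', h, hu⟩)
    · cases h
    · injection h with h
      exact h ▸ hu
  · exact fun h => Or.inr ⟨u, rfl, h⟩

theorem mark_notMem_modBox {u : W} : mark u ∉ H.modBox r a := by
  rintro (⟨_, _, h, _⟩ | ⟨u', h, hu⟩) <;> cases h

theorem mark_mem_markBox_iff {u : W} : mark u ∈ H.markBox r a ↔ H.dist a u ≤ 4 * r + 5 := by
  constructor
  · rintro ⟨u', h, hu⟩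
    injection h with h
    exact h ▸ hu
  · exact fun h => ⟨u, rfl, h⟩

theorem link_notMem_markBox {e : Sym2 W} : link e ∉ H.markBox r a := by
  rintro ⟨_, h, _⟩; cases h

theorem seed_notMem_markBox {u : W} : seed u ∉ H.markBox r a := by
  rintro ⟨_, h, _⟩; cases h

/-- If an edge at `a` is pivotal once the marks around `a` are turned off, then the mark of `a` can
be made pivotal by a modification of the edges and seeds around `a`. -/
theorem exists_pivotal_mark (hH : H.Connected) (hab : H.Adj a b)
    (hfar : ∀ v, H.dist a v ≤ r + 1 → H.dist o v < n)
    (h₁ : H.SeedHits r o n (insert (link s(a, b)) T \ H.markBox r a))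
    (h₀ : ¬ H.SeedHits r o n ((T \ {link s(a, b)}) \ H.markBox r a)) :
    ∃ A ⊆ H.modBox r a,
      H.SeedHits r o n (insert (mark a) (T \ (H.markBox r a ∪ H.modBox r a) ∪ A)) ∧
      ¬ H.SeedHits r o n ((T \ (H.markBox r a ∪ H.modBox r a) ∪ A) \ {mark a}) := by
  set Tm : Set (PercItem W) := T \ (H.markBox r a ∪ H.modBox r a) with hTm
  have heT : ∀ x y, link s(x, y) ∈ Tm ↔ link s(x, y) ∈ T ∧
      ¬ (H.Adj x y ∧ (H.dist a x ≤ r ∨ H.dist a y ≤ r)) := fun x y => by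
    rw [hTm, Set.mem_sdiff, Set.mem_union, link_mem_modBox_iff]
    simp only [link_notMem_markBox, false_or]
  have hsT : ∀ u, seed u ∈ Tm ↔ seed u ∈ T ∧ 2 * r + 2 < H.dist a u := fun u => by
    rw [hTm, Set.mem_sdiff, Set.mem_union, seed_mem_modBox_iff]
    simp only [seed_notMem_markBox, false_or, not_le]
  have hmT : ∀ u, mark u ∈ Tm ↔ mark u ∈ T ∧ 4 * r + 5 < H.dist a u := fun u => by
    rw [hTm, Set.mem_sdiff, Set.mem_union, mark_mem_markBox_iff]
    simp only [mark_notMem_modBox, or_false, not_le]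
  have tri : ∀ x y z, H.dist x z ≤ H.dist x y + H.dist y z := fun x y z => hH.dist_triangle
  set R := H.EnhArc r {u | H.IsEligible r Tm u} Tm with hR
  -- arcs of the emptied configuration
  have hA1 : ∀ x y, R x y → H.EnhArc r {u | H.IsEligible r ((T \ {link s(a, b)}) \ H.markBox r a) u}
      ((T \ {link s(a, b)}) \ H.markBox r a) x y := by
    intro x y hxy
    refine hxy.mono (fun e => ?_) fun hx hm => ?_
    · induction e using Sym2.ind with | h u v => ?_
      intro he
      rw [heT] at he
      refine ⟨⟨he.1, fun h' => he.2 ?_⟩, link_notMem_markBox⟩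
      rw [Set.mem_singleton_iff] at h'
      injection h' with h'
      rcases Sym2.eq_iff.1 h' with ⟨rfl, rfl⟩ | ⟨rfl, rfl⟩
      · exact ⟨hab, by simp⟩
      · exact ⟨hab.symm, by simp⟩
    · rw [hmT] at hm
      refine ⟨⟨⟨⟨((hsT _).1 hx.1).1, by simp⟩, seed_notMem_markBox⟩, fun u' h1 h2 h3 => ?_⟩,
        ⟨hm.1, by simp⟩, fun h => ?_⟩
      · refine hx.2 u' h1 h2 ((hsT _).2 ⟨h3.1.1, ?_⟩)
        have := tri a u' x
        rw [H.dist_comm (u := u')] at this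
        omega
      · rw [mark_mem_markBox_iff] at h
        omega
  -- Emptying the boxes destroys arcs only inside the `r + 1`-ball. The radius `4 * r + 5` exceeds
  -- `(2 * r + 2) + (2 * r + 2)`, so resampled seeds do not affect the eligibility of the remaining
  -- marks.
  have hA2 : ∀ x y, H.EnhArc r {u | H.IsEligible r (insert (link s(a, b)) T \ H.markBox r a) u}
      (insert (link s(a, b)) T \ H.markBox r a) x y →
      R x y ∨ (H.dist a x ≤ r + 1 ∧ H.dist a y ≤ r + 1) := by
    have hin : ∀ x y, link s(x, y) ∈ insert (link s(a, b)) T \ H.markBox r a →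
        ¬ (H.dist a x ≤ r ∨ H.dist a y ≤ r) → link s(x, y) ∈ Tm := by
      intro x y h hn
      rw [heT]
      refine ⟨h.1.resolve_left fun h' => hn ?_, fun h' => hn h'.2⟩
      injection h' with h'
      rcases Sym2.eq_iff.1 h' with ⟨rfl, rfl⟩ | ⟨rfl, rfl⟩ <;> simp
    intro x y hxy
    rcases hxy with ⟨h1, h2⟩ | ⟨h1, h2, h3, h4⟩
    · by_cases hn : H.dist a x ≤ r ∨ H.dist a y ≤ r
      · right
        have i1 := hH.dist_le_succ (x := a) h1
        have i2 := hH.dist_le_succ (x := a) h1.symm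
        omega
      · exact Or.inl (Or.inl ⟨h1, hin x y h2 hn⟩)
    · left
      have hx : 4 * r + 5 < H.dist a x := by
        by_contra hc
        exact h2.2 (mark_mem_markBox_iff.2 (not_lt.1 hc))
      have h2' : mark x ∈ T := by simpa using h2.1
      have h1s : seed x ∈ T := by simpa using h1.1.1
      refine Or.inr ⟨⟨(hsT _).2 ⟨h1s, by omega⟩, fun u' e1 e2 e3 => h1.2 u' e1 e2
        ⟨Or.inr ((hsT _).1 e3).1, seed_notMem_markBox⟩⟩, (hmT _).2 ⟨h2', hx⟩, ?_, h4⟩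
      intro y z hyz hy hz
      refine hin y z (h3 y z hyz hy hz) ?_
      have i1 := tri a y x
      have i2 := tri a z x
      rw [H.dist_comm (u := y)] at i1
      rw [H.dist_comm (u := z)] at i2
      omega
  have hno : ∀ t, n ≤ H.dist o t → ¬ ReflTransGen R o t := fun t ht h =>
    h₀ ⟨t, ht, ReflTransGen.mono hA1 _ _ h⟩
  obtain ⟨t, ht, hot⟩ := h₁
  -- The path must use a destroyed arc: `c` is where it first needs one, `y` where it leaves the
  -- last one. Both are within `r + 1` of `a`.
  obtain ⟨c, _, hoc, hca, -⟩ := hot.exists_first_exit hA2 (hno t ht)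
  obtain ⟨_, y, ⟨-, hya⟩, hyt⟩ := hot.exists_last_entry hA2 (hno t ht)
  -- the vertices from which the target can be reached
  set D : Set W := {v | ∃ t, n ≤ H.dist o t ∧ ReflTransGen R v t} with hD
  have hDR : ∀ u v, R u v → v ∈ D → u ∈ D := fun u v huv ⟨t, ht, hvt⟩ => ⟨t, ht, hvt.head huv⟩
  have hoD : o ∉ D := fun ⟨t, ht, h⟩ => hno t ht h
  have hcD : c ∉ D := fun ⟨t, ht, h⟩ => hno t ht (hoc.trans h)
  -- In the emptied configuration no arc leaves a vertex of the `r`-ball, and `hfar` keeps the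
  -- target away from it.
  have hKD : ∀ v, H.dist a v ≤ r → v ∉ D := by
    rintro v hv ⟨t, ht, hvt⟩
    rcases hvt.cases_head with rfl | ⟨v', hvv', -⟩
    · have := hfar v (by omega)
      omega
    · rcases hvv' with ⟨h1, h2⟩ | ⟨h1, h2, -⟩
      · exact ((heT _ _).1 h2).2 ⟨h1, Or.inl hv⟩
      · have := ((hmT _).1 h2).2
        omega
  -- Open the inside of the ball and its edges to `c`, and seed only `a`. Then `o` reaches `a`
  -- through `c`, while leaving towards `y` requires the mark of `a`.
  set A : Set (PercItem W) := {i | (∃ x y, i = link s(x, y) ∧ H.Adj x y ∧ H.dist a x ≤ r ∧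
    (H.dist a y ≤ r ∨ y = c)) ∨ i = seed a} with hA
  have hAe : ∀ {x y}, link s(x, y) ∈ A → ((H.dist a x ≤ r ∧ (H.dist a y ≤ r ∨ y = c)) ∨
      (H.dist a y ≤ r ∧ (H.dist a x ≤ r ∨ x = c))) := by
    rintro x y (⟨x', y', h, -, h1, h2⟩ | h)
    · injection h with h
      rcases Sym2.eq_iff.1 h with ⟨rfl, rfl⟩ | ⟨rfl, rfl⟩
      · exact Or.inl ⟨h1, h2⟩
      · exact Or.inr ⟨h1, h2⟩
    · cases h
  have hAs : ∀ {u}, seed u ∈ A → u = a := by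
    rintro u (⟨_, _, h, -⟩ | h)
    · cases h
    · injection h
  have hAm : ∀ {u}, mark u ∉ A := by
    rintro u (⟨_, _, h, -⟩ | h) <;> cases h
  refine ⟨A, ?_, ?_, ?_⟩
  · rintro i (⟨x, y, rfl, hxy, hx, -⟩ | rfl)
    · exact link_mem_modBox_iff.2 ⟨hxy, Or.inl hx⟩
    · exact seed_mem_modBox_iff.2 (by simp)
  · set T' := insert (mark a) (Tm ∪ A) with hT'
    set R' := H.EnhArc r {u | H.IsEligible r T' u} T' with hR'
    have hRR' : ∀ x y, R x y → R' x y := by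
      intro x y hxy
      refine hxy.mono (fun e he => Or.inr (Or.inl he)) fun hx hm =>
        ⟨⟨Or.inr (Or.inl hx.1), fun u' h1 h2 h3 => ?_⟩, Or.inr (Or.inl hm)⟩
      rcases h3 with h3 | h3 | h3
      · cases h3
      · exact hx.2 u' h1 h2 h3
      · rw [hAs h3, dist_comm] at h2
        have := ((hmT _).1 hm).2
        omega
    have hK : ∀ v, H.dist a v ≤ r → ReflTransGen R' v a := by
      intro v hv
      induction hH.reflTransGen_distBall hv with
      | refl => exact .refl
      | @tail y z _ hyz ih =>
        refine (ih hyz.2.1).head (Or.inl ⟨hyz.1.symm, Or.inr (Or.inr (Or.inl ?_))⟩)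
        exact ⟨z, y, rfl, hyz.1.symm, hyz.2.2, Or.inl hyz.2.1⟩
    have hca' : ReflTransGen R' c a := by
      rcases Nat.lt_or_ge r (H.dist a c) with hlt | hle
      · obtain ⟨z, hzc, hz⟩ := hH.exists_adj_of_dist_succ (x := a) (y := c) (n := r)
          (le_antisymm hca hlt)
        refine (hK z hz.le).head (Or.inl ⟨hzc.symm, Or.inr (Or.inr (Or.inl ?_))⟩)
        exact ⟨z, c, by rw [Sym2.eq_swap], hzc, hz.le, Or.inr rfl⟩
      · exact hK c hle
    have hay : R' a y := by
      refine Or.inr ⟨⟨Or.inr (Or.inr (Or.inr rfl)), fun u' h1 h2 h3 => ?_⟩, Or.inl rfl, ?_, hya⟩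
      · rcases h3 with h3 | h3 | h3
        · cases h3
        · have := ((hsT _).1 h3).2
          omega
        · exact h1 (hAs h3)
      · exact fun x z hxz hx hz => Or.inr (Or.inr (Or.inl ⟨x, z, rfl, hxz, hx, Or.inl hz⟩))
    exact ⟨t, ht, (ReflTransGen.mono hRR' _ _ hoc).trans
      (hca'.trans ((ReflTransGen.mono hRR' _ _ hyt).head hay))⟩
  · rintro ⟨t, ht, hot⟩
    -- Without the mark, every new edge has both ends in the `r`-ball or at `c`, hence outside `D`,
    -- and arcs from distant marks are unchanged. So the complement of `D` is closed.
    refine ReflTransGen.closed (S := Dᶜ) (fun u v hu huv hv => ?_) hot hoD ⟨t, ht, .refl⟩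
    rcases huv with ⟨h1, h2⟩ | ⟨h1, h2, h3, h4⟩
    · rcases h2.1 with h2 | h2
      · exact hu (hDR u v (Or.inl ⟨h1, h2⟩) hv)
      · rcases hAe h2 with ⟨-, h | rfl⟩ | ⟨h, -⟩
        · exact hKD v h hv
        · exact hcD hv
        · exact hKD v h hv
    · have hm : mark u ∈ Tm := h2.1.resolve_right hAm
      have hfu := ((hmT _).1 hm).2
      refine hu (hDR u v (Or.inr ⟨⟨?_, fun u' e1 e2 e3 => h1.2 u' e1 e2 ⟨Or.inl e3, by simp⟩⟩,
        hm, ?_, h4⟩) hv)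
      · refine h1.1.1.resolve_right fun h => ?_
        rw [hAs h] at hfu
        simp at hfu
      · intro x z hxz hx hz
        refine (h3 x z hxz hx hz).1.resolve_right fun h => ?_
        have i1 := tri a x u
        have i2 := tri a z u
        rw [H.dist_comm (u := x)] at i1
        rw [H.dist_comm (u := z)] at i2
        rcases hAe h with ⟨h, -⟩ | ⟨h, -⟩ <;> omega

end SimpleGraph

/-- The real-valued indicator of a proposition. -/
noncomputable def propInd (P : Prop) : ℝ := open Classical in if P then 1 else 0

theorem propInd_nonneg (P : Prop) : 0 ≤ propInd P := by
  unfold propInd; split_ifs <;> norm_num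

theorem propInd_le_one (P : Prop) : propInd P ≤ 1 := by
  unfold propInd; split_ifs <;> norm_num

theorem propInd_of {P : Prop} (h : P) : propInd P = 1 := if_pos h

theorem propInd_of_not {P : Prop} (h : ¬ P) : propInd P = 0 := if_neg h

theorem propInd_mono {P Q : Prop} (h : P → Q) : propInd P ≤ propInd Q := by
  by_cases hP : P
  · rw [propInd_of hP, propInd_of (h hP)]
  · rw [propInd_of_not hP]; exact propInd_nonneg Q

/-! ### Comparison of edge and mark influences -/

namespace SimpleGraph

open PercItem Relation

variable {W : Type*} {H : SimpleGraph W} {r : ℕ} {o a b : W} {n m : ℕ}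

theorem finite_itemBox (hH : H.Connected) (hlf : ∀ v, (H.neighborSet v).Finite) (o : W) (n : ℕ) :
    (H.itemBox o n).Finite := by
  have hB := hH.finite_distBall hlf o n
  refine ((((hB.prod hB).image fun q => link s(q.1, q.2)).union (hB.image mark)).union
    (hB.image seed)).subset ?_
  rintro i (⟨x, y, rfl, -, hx, hy⟩ | ⟨u, rfl, hu⟩ | ⟨u, rfl, hu⟩)
  · exact Or.inl (Or.inl ⟨(x, y), ⟨hx, hy⟩, rfl⟩)
  · exact Or.inl (Or.inr ⟨u, hu, rfl⟩)
  · exact Or.inr ⟨u, hu, rfl⟩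

theorem link_mem_itemBox_iff {x y : W} :
    link s(x, y) ∈ H.itemBox o n ↔ H.Adj x y ∧ H.dist o x ≤ n ∧ H.dist o y ≤ n := by
  constructor
  · rintro (⟨x', y', h, hxy, hx, hy⟩ | ⟨u, h, _⟩ | ⟨u, h, _⟩)
    · injection h with h
      rcases Sym2.eq_iff.1 h with ⟨rfl, rfl⟩ | ⟨rfl, rfl⟩
      · exact ⟨hxy, hx, hy⟩
      · exact ⟨hxy.symm, hy, hx⟩
    · cases h
    · cases h
  · exact fun ⟨h1, h2, h3⟩ => Or.inl ⟨x, y, rfl, h1, h2, h3⟩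

theorem mark_mem_itemBox_iff {u : W} : mark u ∈ H.itemBox o n ↔ H.dist o u ≤ n := by
  constructor
  · rintro (⟨_, _, h, _⟩ | ⟨u, h, hu⟩ | ⟨u, h, _⟩)
    · cases h
    · injection h with h
      exact h ▸ hu
    · cases h
  · exact fun h => Or.inr (Or.inl ⟨u, rfl, h⟩)

/-- This makes influences nonnegative, except possibly those of seeds; the weight of seeds will stay
fixed. -/
theorem SeedHits.insert_of_sdiff {i : PercItem W} (hi : ∀ u, i ≠ seed u) {T : Set (PercItem W)}
    (h : H.SeedHits r o n (T \ {i})) : H.SeedHits r o n (insert i T) := by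
  refine h.mono (fun j hj => Or.inr hj.1) fun u hu => ⟨?_, fun h' => hi u h'.symm⟩
  exact hu.resolve_left fun h' => hi u h'.symm

set_option maxHeartbeats 1000000 in
open Classical in
/-- The influence of an edge is bounded by the total influence of the marks around it. -/
theorem link_influence_le (hH : H.Connected) {S : Finset (PercItem W)} {p : PercItem W → ℝ}
    {c : ℝ} {k : ℕ} (hc0 : 0 < c) (hc1 : c ≤ 1) (hp0 : ∀ i ∈ S, 0 ≤ p i) (hp1 : ∀ i ∈ S, p i ≤ 1)
    (hlow : ∀ i ∈ S, (∀ u, i ≠ mark u) → c ≤ p i) (hupp : ∀ i ∈ S, c ≤ 1 - p i)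
    (hab : H.Adj a b) (hfar : ∀ v, H.dist a v ≤ r + 1 → H.dist o v < n)
    {B : Finset W} (hB : ∀ u, u ∈ B ↔ H.dist a u ≤ 4 * r + 5)
    {M : Finset (PercItem W)} (hM : (M : Set (PercItem W)) = H.modBox r a)
    (hBS : ∀ u ∈ B, mark u ∈ S) (hMS : M ⊆ S) (hk : B.card + M.card ≤ k) :
    c ^ k * bernoulliExp S p (fun T => propInd (H.SeedHits r o n (insert (link s(a, b)) T)) -
        propInd (H.SeedHits r o n (T \ {link s(a, b)}))) ≤
      (1 + 2 ^ k) * ∑ u ∈ B, bernoulliExp S p (fun T =>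
        propInd (H.SeedHits r o n (insert (mark u) T)) -
        propInd (H.SeedHits r o n (T \ {mark u}))) := by
  set f : Set (PercItem W) → ℝ := fun T => propInd (H.SeedHits r o n T) with hf
  set d : W → Set (PercItem W) → ℝ := fun u T => f (insert (mark u) T) - f (T \ {mark u}) with hd
  set e : PercItem W := link s(a, b) with he
  have hd0 : ∀ u T, 0 ≤ d u T := fun u T => sub_nonneg.2
    (propInd_mono (SeedHits.insert_of_sdiff (by simp)))
  have hE0 : ∀ u, 0 ≤ bernoulliExp S p (d u) := fun u =>
    bernoulliExp.nonneg hp0 hp1 fun T _ => hd0 u T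
  have heM : e ∈ M := by
    rw [← Finset.mem_coe, hM, he, link_mem_modBox_iff]
    exact ⟨hab, by simp⟩
  have haB : a ∈ B := (hB a).2 (by simp)
  -- Marks are only ever forced off. This keeps the bound valid when the mark parameter is near or
  -- equal to `0`.
  have hmod : ∀ (L A : Finset (PercItem W)) (u : W), A ⊆ L → L ⊆ S → L.card ≤ k →
      (∀ i ∈ A, ∀ u, i ≠ mark u) →
      c ^ k * bernoulliExp S p (fun T => d u (T \ L ∪ A)) ≤ bernoulliExp S p (d u) := by
    intro L A u hAL hLS hLk hA
    refine le_trans (mul_le_mul_of_nonneg_right (pow_le_pow_of_le_one hc0.le hc1 hLk)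
      (bernoulliExp.nonneg hp0 hp1 fun T _ => hd0 u _)) ?_
    exact bernoulliExp.modify_le hp0 hp1 hc0.le L A hAL hLS
      (fun i hi => hlow i (hLS (hAL hi)) (hA i hi))
      (fun i hi => hupp i (hLS (Finset.sdiff_subset hi))) (d u) (hd0 u)
  -- turn off the marks one by one
  have step1 : ∀ B' ⊆ B, c ^ k * (bernoulliExp S p (fun T => f (insert e T)) -
      bernoulliExp S p (fun T => f (insert e T \ (B'.image mark : Finset _)))) ≤
      ∑ u ∈ B', bernoulliExp S p (d u) := by
    intro B'
    induction B' using Finset.induction_on with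
    | empty => intro _; simp
    | insert u B' hu ih =>
      intro hB'
      have ih' := ih ((Finset.subset_insert _ _).trans hB')
      rw [Finset.sum_insert hu]
      -- Turning off one more mark costs an influence of that mark in a configuration where `e` is
      -- open and the earlier marks are off; forcing this costs at most `c ^ k`.
      set L : Finset (PercItem W) := insert e (B'.image mark) with hL
      have key := hmod L {e} u (by simp [hL])
        (by
          intro i hi
          rw [hL, Finset.mem_insert, Finset.mem_image] at hi
          rcases hi with rfl | ⟨v, hv, rfl⟩
          · exact hMS heM
          · exact hBS v (hB' (Finset.mem_insert_of_mem hv)))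
        (by
          have h1 := Finset.card_insert_le e (B'.image mark)
          rw [← hL] at h1
          have h2 : (B'.image mark).card ≤ B'.card := Finset.card_image_le
          have h3 : B'.card ≤ B.card := Finset.card_le_card ((Finset.subset_insert _ _).trans hB')
          have h4 : 0 < M.card := Finset.card_pos.2 ⟨e, heM⟩
          omega)
        (by simp [he])
      have hle : bernoulliExp S p (fun T => f (insert e T \ (B'.image mark : Finset _))) -
          bernoulliExp S p (fun T => f (insert e T \ ((insert u B').image mark : Finset _))) ≤
          bernoulliExp S p (fun T => d u (T \ L ∪ ({e} : Finset _))) := by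
        rw [← bernoulliExp.sub]
        refine bernoulliExp.mono hp0 hp1 fun T _ => ?_
        have e1 : T \ L ∪ ({e} : Finset _) = insert e T \ (B'.image mark : Finset _) := by
          ext i
          by_cases hi : i = e
          · simp [hi, he]
          · simp [hi, hL]
        have e2 : insert e T \ ((insert u B').image mark : Finset _) =
            (insert e T \ (B'.image mark : Finset _)) \ {mark u} := by
          ext i
          simp only [Finset.coe_image, Finset.coe_insert, Set.image_insert_eq, Set.mem_sdiff,
            Set.mem_insert_iff, Set.mem_singleton_iff]
          tauto
        rw [e1, e2, hd]
        refine sub_le_sub_right (propInd_mono fun h => h.mono (Set.subset_insert _ _) ?_) _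
        intro v hv
        exact hv.resolve_left (by simp)
      have := (mul_le_mul_of_nonneg_left hle (pow_nonneg hc0.le k)).trans key
      rw [mul_sub] at this ih' ⊢
      linarith
  have h1 := step1 B subset_rfl
  have hmb : ((B.image mark : Finset (PercItem W)) : Set (PercItem W)) = H.markBox r a := by
    ext i
    simp only [Finset.coe_image, Set.mem_image, Finset.mem_coe, hB, markBox, Set.mem_ofPred_eq]
    exact ⟨fun ⟨u, h, h'⟩ => ⟨u, h'.symm, h⟩, fun ⟨u, h, h'⟩ => ⟨u, h', h.symm⟩⟩
  rw [hmb] at h1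
  -- local modification
  set L : Finset (PercItem W) := B.image mark ∪ M with hL
  have hLc : (L : Set (PercItem W)) = H.markBox r a ∪ H.modBox r a := by
    rw [hL, Finset.coe_union, hmb, hM]
  have h2 : c ^ k * (bernoulliExp S p (fun T => f (insert e T \ H.markBox r a)) -
      bernoulliExp S p (fun T => f ((T \ {e}) \ H.markBox r a))) ≤
      2 ^ k * bernoulliExp S p (d a) := by
    -- The modification `A` depends on `T`, so it is replaced by the sum over all subsets of `M`;
    -- this is the source of the factor `2 ^ k`.
    have hle : bernoulliExp S p (fun T => f (insert e T \ H.markBox r a)) -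
        bernoulliExp S p (fun T => f ((T \ {e}) \ H.markBox r a)) ≤
        ∑ A ∈ M.powerset, bernoulliExp S p (fun T => d a (T \ L ∪ A)) := by
      rw [← bernoulliExp.sub, ← bernoulliExp.sum]
      refine bernoulliExp.mono hp0 hp1 fun T _ => ?_
      have hs0 : 0 ≤ ∑ A ∈ M.powerset, d a (T \ L ∪ A) := Finset.sum_nonneg fun A _ => hd0 a _
      change f (insert e T \ H.markBox r a) - f ((T \ {e}) \ H.markBox r a) ≤
        ∑ A ∈ M.powerset, d a (T \ L ∪ A)
      by_cases hh1 : H.SeedHits r o n (insert e T \ H.markBox r a)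
      · have f1 : f (insert e T \ H.markBox r a) = 1 := propInd_of hh1
        by_cases hh0 : H.SeedHits r o n ((T \ {e}) \ H.markBox r a)
        · have f0 : f ((T \ {e}) \ H.markBox r a) = 1 := propInd_of hh0
          rw [f1, f0, sub_self]
          exact hs0
        · obtain ⟨A, hA, hA1, hA0⟩ := exists_pivotal_mark hH hab hfar hh1 hh0
          have f0 : f ((T \ {e}) \ H.markBox r a) = 0 := propInd_of_not hh0
          obtain ⟨A, rfl⟩ : ∃ A' : Finset (PercItem W), (A' : Set (PercItem W)) = A :=
            ⟨(M.finite_toSet.subset (hM ▸ hA)).toFinset, Set.Finite.coe_toFinset _⟩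
          have hmem : A ∈ M.powerset := by
            rw [Finset.mem_powerset, ← Finset.coe_subset, hM]
            exact hA
          have hval : d a (T \ L ∪ A) = 1 := by
            have d1 : f (insert (mark a) (T \ L ∪ A)) = 1 := by
              rw [hLc]; exact propInd_of hA1
            have d0 : f ((T \ L ∪ A) \ {mark a}) = 0 := by
              rw [hLc]; exact propInd_of_not hA0
            rw [hd]
            change f (insert (mark a) (T \ L ∪ A)) - f ((T \ L ∪ A) \ {mark a}) = 1
            rw [d1, d0, sub_zero]
          rw [f1, f0, sub_zero, ← hval]
          exact Finset.single_le_sum (f := fun A : Finset _ => d a (T \ L ∪ A))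
            (fun A _ => hd0 a _) hmem
      · have f1 : f (insert e T \ H.markBox r a) = 0 := propInd_of_not hh1
        have f0 : 0 ≤ f ((T \ {e}) \ H.markBox r a) := propInd_nonneg _
        rw [f1]
        linarith
    refine le_trans (mul_le_mul_of_nonneg_left hle (pow_nonneg hc0.le k)) ?_
    rw [Finset.mul_sum]
    refine le_trans (Finset.sum_le_sum fun A hA => hmod L A a ?_ ?_ ?_ ?_) ?_
    · exact (Finset.mem_powerset.1 hA).trans Finset.subset_union_right
    · refine Finset.union_subset (fun i hi => ?_) hMS
      obtain ⟨u, hu, rfl⟩ := Finset.mem_image.1 hi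
      exact hBS u hu
    · exact (Finset.card_union_le _ _).trans
        ((Nat.add_le_add_right Finset.card_image_le _).trans hk)
    · rintro i hi u rfl
      have : mark u ∈ H.modBox r a := hM ▸ Finset.mem_powerset.1 hA hi
      exact mark_notMem_modBox this
    · rw [Finset.sum_const, Finset.card_powerset, nsmul_eq_mul]
      refine mul_le_mul_of_nonneg_right ?_ (hE0 a)
      push_cast
      exact pow_le_pow_right₀ (by norm_num) (by omega)
  have h3 : bernoulliExp S p (fun T => f ((T \ {e}) \ H.markBox r a)) ≤
      bernoulliExp S p (fun T => f (T \ {e})) :=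
    bernoulliExp.mono hp0 hp1 fun T _ => propInd_mono fun h =>
      h.mono Set.sdiff_subset fun u hu => ⟨hu, seed_notMem_markBox⟩
  have h4 : bernoulliExp S p (d a) ≤ ∑ u ∈ B, bernoulliExp S p (d u) :=
    Finset.single_le_sum (f := fun u => bernoulliExp S p (d u)) (fun u _ => hE0 u) haB
  have h5 := mul_le_mul_of_nonneg_left h3 (pow_nonneg hc0.le k)
  have h6 := mul_le_mul_of_nonneg_left h4 (show (0 : ℝ) ≤ 2 ^ k by positivity)
  change c ^ k * bernoulliExp S p (fun T => f (insert e T) - f (T \ {e})) ≤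
    (1 + 2 ^ k) * ∑ u ∈ B, bernoulliExp S p (d u)
  rw [bernoulliExp.sub]
  nlinarith

/-- The weights of the enhanced model. -/
noncomputable def itemWeight {W : Type*} (p s : ℝ) : PercItem W → ℝ
  | link _ => p
  | mark _ => s
  | seed _ => 1 / 2

end SimpleGraph

/-! ### Trading edge density for enhancement -/

namespace SimpleGraph

open PercItem Relation

variable {W : Type*} {H : SimpleGraph W} {r : ℕ} {o a b : W} {n m : ℕ}

theorem exists_finset_modBox (hH : H.Connected) (hlf : ∀ v, (H.neighborSet v).Finite) {b : ℕ}
    (hb : ∀ x, (H.distBall x (4 * r + 6)).ncard ≤ b) (a : W) :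
    ∃ M : Finset (PercItem W), (M : Set (PercItem W)) = H.modBox r a ∧ M.card ≤ b ^ 2 + b := by
  classical
  have hfin := hH.finite_distBall hlf a (4 * r + 6)
  set F := hfin.toFinset with hF
  have hFc : F.card ≤ b := by
    rw [hF, ← Set.ncard_eq_toFinset_card _ hfin]
    exact hb a
  have hmem : ∀ x, x ∈ F ↔ H.dist a x ≤ 4 * r + 6 := fun x => by
    rw [hF, Set.Finite.mem_toFinset]; exact Iff.rfl
  set I : Finset (PercItem W) := (F ×ˢ F).image (fun q => link s(q.1, q.2)) ∪ F.image seed with hI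
  have hsub : H.modBox r a ⊆ I := by
    rintro i (⟨x, y, rfl, hxy, hx⟩ | ⟨u, rfl, hu⟩)
    · have := hH.dist_le_succ (x := a) hxy
      refine Finset.mem_union_left _ (Finset.mem_image.2 ⟨(x, y), ?_, rfl⟩)
      exact Finset.mem_product.2 ⟨(hmem _).2 (by simp only; omega),
        (hmem _).2 (by simp only; omega)⟩
    · exact Finset.mem_union_right _ (Finset.mem_image.2 ⟨u, (hmem _).2 (by omega), rfl⟩)
  refine ⟨(I.finite_toSet.subset hsub).toFinset, Set.Finite.coe_toFinset _, ?_⟩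
  have h1 : (I.finite_toSet.subset hsub).toFinset.card ≤ I.card := Finset.card_le_card (by simpa)
  have h2 : I.card ≤ (F ×ˢ F).card + F.card := (Finset.card_union_le _ _).trans
    (Nat.add_le_add Finset.card_image_le Finset.card_image_le)
  rw [Finset.card_product] at h2
  have h3 : F.card * F.card ≤ b ^ 2 := by
    rw [sq]; exact Nat.mul_le_mul hFc hFc
  omega

set_option maxHeartbeats 1000000 in
/-- Activating the enhancement compensates for a decrease of the edge parameter, at a rate that only
depends on the local geometry. -/
theorem exists_interpolation_rate (hH : H.Connected) (hlf : ∀ v, (H.neighborSet v).Finite) {b : ℕ}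
    (hb : ∀ x, (H.distBall x (4 * r + 6)).ncard ≤ b) {c : ℝ} (hc0 : 0 < c) (hc : c ≤ 1 / 2) :
    ∃ κ : ℝ, 0 < κ ∧ ∀ (o : W) (N : ℕ) (p s : ℝ), 0 ≤ s → s ≤ 1 / 2 → c ≤ p - κ * s → p ≤ 1 - c →
      ∃ n, N ≤ n ∧
        bernoulliExp (finite_itemBox hH hlf o n).toFinset (itemWeight p 0)
          (fun T => propInd (H.SeedHits r o n T)) ≤
        bernoulliExp (finite_itemBox hH hlf o (N + r)).toFinset (itemWeight (p - κ * s) s)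
          (fun T => propInd (H.SeedHits r o N T)) := by
  classical
  set k := b + (b ^ 2 + b) with hk
  have hck : 0 < c ^ k := pow_pos hc0 k
  have hKpos : (0 : ℝ) < (1 + 2 ^ k) * (b ^ 2 + 1) := by positivity
  refine ⟨c ^ k / ((1 + 2 ^ k) * (b ^ 2 + 1)), by positivity, ?_⟩
  -- The factors are the modification cost from `link_influence_le` and the number, at most `b ^ 2`,
  -- of edges charging a given mark; the extra `1` ensures positivity.
  set κ := c ^ k / ((1 + 2 ^ k) * (b ^ 2 + 1)) with hκ
  have hκ0 : 0 < κ := by positivity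
  intro o N p s hs0 hs1 hcp hpc
  have : Nonempty W := ⟨o⟩
  -- Edges are weakened only in the box of radius `N + r`; the marks charged by them lie at most `4
  -- * r + 5` further out, so within `n`.
  refine ⟨N + 5 * r + 5, by omega, ?_⟩
  set n := N + 5 * r + 5 with hn
  set S := (finite_itemBox hH hlf o n).toFinset with hS
  set S₁ := (finite_itemBox hH hlf o (N + r)).toFinset with hS₁
  have hmS : ∀ i, i ∈ S ↔ i ∈ H.itemBox o n := fun i => Set.Finite.mem_toFinset _
  have hmS₁ : ∀ i, i ∈ S₁ ↔ i ∈ H.itemBox o (N + r) := fun i => Set.Finite.mem_toFinset _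
  have hS₁S : S₁ ⊆ S := by
    intro i hi
    rw [hmS₁] at hi
    rw [hmS]
    rcases hi with ⟨x, y, rfl, h1, h2, h3⟩ | ⟨u, rfl, hu⟩ | ⟨u, rfl, hu⟩
    · exact Or.inl ⟨x, y, rfl, h1, by omega, by omega⟩
    · exact Or.inr (Or.inl ⟨u, rfl, by omega⟩)
    · exact Or.inr (Or.inr ⟨u, rfl, by omega⟩)
  set f : Set (PercItem W) → ℝ := fun T => propInd (H.SeedHits r o n T) with hf
  set U := (hH.finite_distBall hlf o n).toFinset with hU
  have hmU : ∀ u, u ∈ U ↔ H.dist o u ≤ n := fun u => by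
    rw [hU, Set.Finite.mem_toFinset]; exact Iff.rfl
  set Mk : Finset (PercItem W) := U.image mark with hMk
  set Lk : Finset (PercItem W) := S₁.filter fun i => ∃ e, i = link e with hLk
  have hMkS : Mk ⊆ S := by
    intro i hi
    obtain ⟨u, hu, rfl⟩ := Finset.mem_image.1 hi
    rw [hmS, mark_mem_itemBox_iff]
    exact (hmU u).1 hu
  have hLkS : Lk ⊆ S := (Finset.filter_subset _ _).trans hS₁S
  have hmkMk : ∀ u, mark u ∈ S → mark u ∈ Mk := fun u hu => by
    rw [hmS, mark_mem_itemBox_iff] at hu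
    exact Finset.mem_image.2 ⟨u, (hmU u).2 hu, rfl⟩
  -- The direction of the interpolation: marks grow at unit speed, inner edges decrease at speed
  -- `κ`, outer edges and seeds stay put.
  set w' : PercItem W → ℝ := fun i => (if i ∈ Mk then 1 else 0) - κ * (if i ∈ Lk then 1 else 0)
    with hw'
  set w : PercItem W → ℝ → ℝ := fun i t => itemWeight p 0 i + w' i * t with hw
  have hw'link : ∀ e, w' (link e) = -κ * (if link e ∈ Lk then 1 else 0) := fun e => by
    have : link e ∉ Mk := by simp [hMk]
    by_cases he : link e ∈ Lk <;> simp [hw', this, he]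
  have hw'mark : ∀ u, mark u ∈ S → w' (mark u) = 1 := fun u hu => by
    have : mark u ∉ Lk := by simp [hLk]
    simp [hw', this, hmkMk u hu]
  have hw'seed : ∀ u, w' (seed u) = 0 := fun u => by
    have h1 : seed u ∉ Lk := by simp [hLk]
    have h2 : seed u ∉ Mk := by simp [hMk]
    simp [hw', h1, h2]
  -- bounds for the weights
  have hwlink : ∀ e, ∀ t ∈ Set.Icc 0 s, c ≤ w (link e) t ∧ w (link e) t ≤ 1 - c := by
    intro e t ht
    have h1 : w (link e) t = p + w' (link e) * t := rfl
    rw [h1, hw'link]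
    have h2 := mul_nonneg hκ0.le ht.1
    have h3 := mul_le_mul_of_nonneg_left ht.2 hκ0.le
    split_ifs
    · constructor <;> linarith
    · constructor <;> linarith [mul_nonneg hκ0.le hs0]
  have hwmark : ∀ u, mark u ∈ S → ∀ t, w (mark u) t = t := by
    intro u hu t
    have h1 : w (mark u) t = 0 + w' (mark u) * t := rfl
    rw [h1, hw'mark u hu]; ring
  have hwseed : ∀ u t, w (seed u) t = 1 / 2 := by
    intro u t
    have h1 : w (seed u) t = 1 / 2 + w' (seed u) * t := rfl
    rw [h1, hw'seed u]; ring
  have hlow : ∀ t ∈ Set.Icc 0 s, ∀ i ∈ S, (∀ u, i ≠ mark u) → c ≤ w i t := by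
    intro t ht i hi hne
    cases i with
    | link e => exact (hwlink e t ht).1
    | mark u => exact absurd rfl (hne u)
    | seed u => rw [hwseed]; exact hc
  have hupp : ∀ t ∈ Set.Icc 0 s, ∀ i ∈ S, c ≤ 1 - w i t := by
    intro t ht i hi
    cases i with
    | link e => linarith [(hwlink e t ht).2]
    | mark u => rw [hwmark u hi]; linarith [ht.2]
    | seed u => rw [hwseed]; linarith
  have hp0 : ∀ t ∈ Set.Icc 0 s, ∀ i ∈ S, 0 ≤ w i t := by
    intro t ht i hi
    cases i with
    | link e => exact hc0.le.trans (hwlink e t ht).1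
    | mark u => rw [hwmark u hi]; exact ht.1
    | seed u => rw [hwseed]; norm_num
  have hp1 : ∀ t ∈ Set.Icc 0 s, ∀ i ∈ S, w i t ≤ 1 := fun t ht i hi => by
    linarith [hupp t ht i hi]
  -- the derivative
  set Df : ℝ → PercItem W → ℝ := fun t i => bernoulliExp S (fun i => w i t)
    (fun T => f (insert i T) - f (T \ {i})) with hDf
  have hderiv : ∀ t, HasDerivAt (fun t => bernoulliExp S (fun i => w i t) f)
      (∑ i ∈ S, w' i * Df t i) t := fun t =>
    bernoulliExp.hasDerivAt (w := w) (w' := w') (fun i _ => by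
      have := ((hasDerivAt_id t).const_mul (w' i)).const_add (itemWeight p 0 i)
      simpa [hw] using this) f
  have hnonneg : ∀ t ∈ Set.Icc 0 s, 0 ≤ ∑ i ∈ S, w' i * Df t i := by
    intro t ht
    have hsum : ∑ i ∈ S, w' i * Df t i = ∑ u ∈ U, Df t (mark u) - κ * ∑ i ∈ Lk, Df t i := by
      have e1 : ∑ i ∈ S, (if i ∈ Mk then 1 else 0) * Df t i = ∑ u ∈ U, Df t (mark u) := by
        simp only [ite_mul, one_mul, zero_mul]
        rw [Finset.sum_ite_mem, Finset.inter_eq_right.2 hMkS, hMk, Finset.sum_image]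
        intro u _ v _ huv
        injection huv
      have e2 : ∑ i ∈ S, (if i ∈ Lk then 1 else 0) * Df t i = ∑ i ∈ Lk, Df t i := by
        simp only [ite_mul, one_mul, zero_mul]
        rw [Finset.sum_ite_mem, Finset.inter_eq_right.2 hLkS]
      rw [← e1, ← e2, Finset.mul_sum, ← Finset.sum_sub_distrib]
      refine Finset.sum_congr rfl fun i _ => ?_
      simp only [hw']
      ring
    rw [hsum]
    have hDm0 : ∀ u, 0 ≤ Df t (mark u) := fun u => bernoulliExp.nonneg (hp0 t ht) (hp1 t ht)
      fun T _ => sub_nonneg.2 (propInd_mono (SeedHits.insert_of_sdiff (by simp)))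
    have hrep : ∀ i ∈ Lk, ∃ x y, i = link s(x, y) ∧ H.Adj x y ∧ H.dist o x ≤ N + r := by
      intro i hi
      obtain ⟨hi, e, rfl⟩ := Finset.mem_filter.1 hi
      rw [hmS₁] at hi
      rcases hi with ⟨x, y, h, h1, h2, h3⟩ | ⟨u, h, _⟩ | ⟨u, h, _⟩
      · exact ⟨x, y, h, h1, h2⟩
      · cases h
      · cases h
    choose! x y hxy hadj hxo using hrep
    set B : W → Finset W := fun v => (hH.finite_distBall hlf v (4 * r + 5)).toFinset with hB
    have hmB : ∀ v u, u ∈ B v ↔ H.dist v u ≤ 4 * r + 5 := fun v u => by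
      simp only [hB]
      rw [Set.Finite.mem_toFinset]; exact Iff.rfl
    have hinf : ∀ i ∈ Lk, c ^ k * Df t i ≤ (1 + 2 ^ k) * ∑ u ∈ B (x i), Df t (mark u) := by
      intro i hi
      have hxi := hxo i hi
      obtain ⟨M, hM, hMc⟩ := exists_finset_modBox hH hlf hb (x i)
      have hBc : (B (x i)).card ≤ b := by
        refine le_trans ?_ (hb (x i))
        simp only [hB]
        rw [← Set.ncard_eq_toFinset_card _ (hH.finite_distBall hlf (x i) (4 * r + 5))]
        refine Set.ncard_le_ncard (fun u hu => ?_) (hH.finite_distBall hlf _ _)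
        exact le_trans (show H.dist (x i) u ≤ 4 * r + 5 from hu) (by omega)
      have hox : ∀ v d, H.dist (x i) v ≤ d → H.dist o v ≤ N + r + d := fun v d hv => by
        have := hH.dist_triangle (u := o) (v := x i) (w := v)
        omega
      have key := link_influence_le (o := o) (n := n) hH (S := S) (p := fun i => w i t) (k := k) hc0
        (by linarith) (hp0 t ht) (hp1 t ht) (hlow t ht) (hupp t ht) (hadj i hi)
        (fun v hv => by have := hox v _ hv; omega) (hmB (x i)) hM
        (fun u hu => by
          have := hox u _ ((hmB _ _).1 hu)
          rw [hmS, mark_mem_itemBox_iff]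
          omega)
        (by
          intro j hj
          rw [hmS]
          rw [← Finset.mem_coe, hM] at hj
          rcases hj with ⟨u, v, rfl, huv, hu⟩ | ⟨u, rfl, hu⟩
          · have h1 := hox u _ hu
            have h2 := hH.dist_le_succ (x := o) huv
            exact Or.inl ⟨u, v, rfl, huv, by omega, by omega⟩
          · have h1 := hox u _ hu
            exact Or.inr (Or.inr ⟨u, rfl, by omega⟩))
        (Nat.add_le_add hBc hMc)
      rw [← hxy i hi] at key
      exact key
    have hcount : ∀ u ∈ U, (Lk.filter fun i => u ∈ B (x i)).card ≤ b ^ 2 := by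
      intro u _
      set F := (hH.finite_distBall hlf u (4 * r + 6)).toFinset with hF
      have hmF : ∀ v, v ∈ F ↔ H.dist u v ≤ 4 * r + 6 := fun v => by
        rw [hF, Set.Finite.mem_toFinset]; exact Iff.rfl
      have hFc : F.card ≤ b := by
        rw [hF, ← Set.ncard_eq_toFinset_card _ (hH.finite_distBall hlf u (4 * r + 6))]
        exact hb u
      have hsub : (Lk.filter fun i => u ∈ B (x i)) ⊆
          (F ×ˢ F).image fun q => link s(q.1, q.2) := by
        intro i hi
        obtain ⟨hi, hu⟩ := Finset.mem_filter.1 hi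
        rw [hmB, dist_comm] at hu
        have := hH.dist_le_succ (x := u) (hadj i hi)
        refine Finset.mem_image.2 ⟨(x i, y i), Finset.mem_product.2
          ⟨(hmF _).2 (by simp only; omega), (hmF _).2 (by simp only; omega)⟩, (hxy i hi).symm⟩
      calc _ ≤ _ := Finset.card_le_card hsub
        _ ≤ (F ×ˢ F).card := Finset.card_image_le
        _ = F.card * F.card := Finset.card_product _ _
        _ ≤ b ^ 2 := by rw [sq]; exact Nat.mul_le_mul hFc hFc
    -- Double counting of pairs consisting of an edge and a mark near it.
    have hswap : ∑ i ∈ Lk, ∑ u ∈ B (x i), Df t (mark u) ≤ b ^ 2 * ∑ u ∈ U, Df t (mark u) := by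
      rw [Finset.sum_comm' (t' := U) (s' := fun u => Lk.filter fun i => u ∈ B (x i))]
      · rw [Finset.mul_sum]
        refine Finset.sum_le_sum fun u hu => ?_
        rw [Finset.sum_const, nsmul_eq_mul]
        exact mul_le_mul_of_nonneg_right (by exact_mod_cast hcount u hu) (hDm0 u)
      · intro i u
        refine ⟨fun h => ⟨Finset.mem_filter.2 h, ?_⟩, fun h => Finset.mem_filter.1 h.1⟩
        have h1 := (hmB _ _).1 h.2
        have h2 := hxo i h.1
        have h3 := hH.dist_triangle (u := o) (v := x i) (w := u)
        rw [hmU]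
        omega
    have htot : c ^ k * ∑ i ∈ Lk, Df t i ≤
        (1 + 2 ^ k) * (b ^ 2 * ∑ u ∈ U, Df t (mark u)) := by
      rw [Finset.mul_sum]
      refine (Finset.sum_le_sum hinf).trans ?_
      rw [← Finset.mul_sum]
      exact mul_le_mul_of_nonneg_left hswap (by positivity)
    have hU0 : 0 ≤ ∑ u ∈ U, Df t (mark u) := Finset.sum_nonneg fun u _ => hDm0 u
    rw [sub_nonneg, hκ, div_mul_eq_mul_div, div_le_iff₀ hKpos]
    refine htot.trans ?_
    have : (0 : ℝ) ≤ (1 + 2 ^ k) * ∑ u ∈ U, Df t (mark u) := by positivity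
    nlinarith
  have hmono : MonotoneOn (fun t => bernoulliExp S (fun i => w i t) f) (Set.Icc 0 s) := by
    refine monotoneOn_of_deriv_nonneg (convex_Icc 0 s)
      (fun t _ => (hderiv t).continuousAt.continuousWithinAt)
      (fun t _ => (hderiv t).differentiableAt.differentiableWithinAt) fun t ht => ?_
    rw [(hderiv t).deriv]
    exact hnonneg t (interior_subset ht)
  have h0s := hmono ⟨le_refl 0, hs0⟩ ⟨hs0, le_refl s⟩ hs0
  have hstart : bernoulliExp S (fun i => w i 0) f = bernoulliExp S (itemWeight p 0) f :=
    bernoulliExp.congr_weight fun i _ => by simp [hw]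
  simp only [hstart] at h0s
  refine h0s.trans ?_
  have hs : s ∈ Set.Icc 0 s := ⟨hs0, le_refl s⟩
  -- Weakening the event from `n` to `N` discards the outer edges, which still have parameter `p`.
  have hend : bernoulliExp S (fun i => w i s) f ≤ bernoulliExp S (fun i => w i s)
      (fun T => (fun T => propInd (H.SeedHits r o N T)) (T ∩ S₁)) := by
    refine bernoulliExp.mono (hp0 s hs) (hp1 s hs) fun T _ => propInd_mono fun h => ?_
    rw [hS₁, Set.Finite.coe_toFinset]
    exact h.inter_itemBox hH (by omega) le_rfl
  refine hend.trans (le_of_eq ?_)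
  rw [bernoulliExp.inter_eq (f := fun T => propInd (H.SeedHits r o N T)) hS₁S]
  refine bernoulliExp.congr_weight fun i hi => ?_
  cases i with
  | link e =>
    have h1 : w (link e) s = p + w' (link e) * s := rfl
    have h2 : link e ∈ Lk := Finset.mem_filter.2 ⟨hi, e, rfl⟩
    rw [h1, hw'link, if_pos h2]
    simp only [itemWeight]; ring
  | mark u => rw [hwmark u (hS₁S hi)]; rfl
  | seed u => rw [hwseed]; rfl

end SimpleGraph

namespace SimpleGraph

open PercItem Relation Filter

/-! ### Lifting the exploration -/

variable {V W : Type*} {G : SimpleGraph V} {H : SimpleGraph W} {π : V → W} {r : ℕ}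

/-- Crossing an edge of `G` that lies in `A`. -/
def OpenStep (G : SimpleGraph V) (A : Set (Sym2 V)) (a b : V) : Prop := G.Adj a b ∧ s(a, b) ∈ A

theorem OpenStep.reach_mono {A A' : Set (Sym2 V)} (h : A ⊆ A') {x y : V}
    (hxy : ReflTransGen (OpenStep G A) x y) : ReflTransGen (OpenStep G A') x y :=
  ReflTransGen.mono (fun _ _ h' => ⟨h'.1, h h'.2⟩) _ _ hxy

/-- The cluster of `x₀` contains a vertex whose projection is at distance `n`. -/
def CoverHits (G : SimpleGraph V) (H : SimpleGraph W) (π : V → W) (x₀ : V) (n : ℕ)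
    (A : Set (Sym2 V)) : Prop :=
  ∃ y, n ≤ H.dist (π x₀) (π y) ∧ ReflTransGen (OpenStep G A) x₀ y

theorem CoverHits.mono {x₀ : V} {n : ℕ} {A A' : Set (Sym2 V)} (h : CoverHits G H π x₀ n A)
    (hA : A ⊆ A') : CoverHits G H π x₀ n A' := by
  obtain ⟨y, hy, hr⟩ := h
  exact ⟨y, hy, OpenStep.reach_mono hA hr⟩

/-- The edges of `G` that the exploration may have found closed: lifts of closed explored edges at
the chosen lift of an explored vertex, and edges spent in an unsuccessful test around a vertex. -/
def SpentEdge (H : SimpleGraph W) (π : V → W) (r : ℕ) (N : Set W) (R T : Set (PercItem W))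
    (C : Set W) (σ : W → V) (f : Sym2 V) : Prop :=
  (∃ a b, f = s(a, b) ∧ π a ∈ C ∧ a = σ (π a) ∧ H.Adj (π a) (π b) ∧
    link s(π a, π b) ∉ R ∧ link s(π a, π b) ∉ T) ∨
  ∃ u ∈ N, mark u ∉ R ∧ H.BallOpen r T u ∧ (∀ v, H.dist u v ≤ r → v ∈ C) ∧
    ∃ a b, f = s(a, b) ∧ H.dist u (π a) ≤ r ∧
      (H.dist u (π b) ≤ r ∨ (H.dist u (π b) ≤ r + 1 ∧ a ≠ σ (π a)))

/-- The reason for being spent survives later steps: newly open items come from the unexplored ones,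
and lifts already chosen are kept. -/
theorem SpentEdge.mono {N : Set W} {R R' T T' : Set (PercItem W)} {C C' : Set W} {σ σ' : W → V}
    {f : Sym2 V} (h : SpentEdge H π r N R T C σ f) (hR : R' ⊆ R) (hT : T ⊆ T') (hTR : T' ⊆ T ∪ R)
    (hC : C ⊆ C') (hσ : ∀ w ∈ C, σ' w = σ w) : SpentEdge H π r N R' T' C' σ' f := by
  rcases h with ⟨a, b, rfl, h1, h2, h3, h4, h5⟩ | ⟨u, hu, h1, h2, h3, a, b, rfl, h4, h5⟩
  · exact Or.inl ⟨a, b, rfl, hC h1, by rw [hσ _ h1]; exact h2, h3, fun h => h4 (hR h),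
      fun h => (hTR h).elim h5 h4⟩
  · refine Or.inr ⟨u, hu, fun h => h1 (hR h), h2.mono fun e he => hT he, fun v hv => hC (h3 v hv),
      a, b, rfl, h4, ?_⟩
    rw [hσ _ (h3 _ h4)]
    exact h5

/-- The state of the lifted exploration: `R` are the unexplored items, `T` the items found open, `C`
the explored cluster, `σ` its lift, `P` the edges of `G` found open and `M` those found closed. -/
structure ExplorationState (G : SimpleGraph V) (H : SimpleGraph W) (π : V → W) (r : ℕ) (N : Set W)
    (x₀ : V) (R T : Set (PercItem W)) (C : Set W) (σ : W → V) (P M : Set (Sym2 V)) : Prop where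
  root : π x₀ ∈ C
  lift : ∀ w ∈ C, π (σ w) = w ∧ ReflTransGen (OpenStep G P) x₀ (σ w)
  links : ∀ u v, H.Adj u v → link s(u, v) ∈ T → u ∈ C ∧ v ∈ C
  marks : ∀ u, mark u ∈ T → ∀ v, H.dist u v ≤ r + 1 → v ∈ C
  disj : Disjoint R T
  spent : ∀ f ∈ M, SpentEdge H π r N R T C σ f

namespace ExplorationState

variable {N : Set W} {x₀ : V} {R T : Set (PercItem W)} {C : Set W} {σ : W → V}
  {P M : Set (Sym2 V)}

theorem ball_subset (hH : H.Connected) (h : ExplorationState G H π r N x₀ R T C σ P M) {u : W}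
    (hu : u ∈ C) (hb : H.BallOpen r T u) : ∀ v, H.dist u v ≤ r → v ∈ C := fun _ hv =>
  (hH.reflTransGen_distBall hv).closed
    (fun _ _ _ hxy => (h.links _ _ hxy.1 (hb _ _ hxy.1 hxy.2.1 hxy.2.2)).2) hu

/-- When no exploration step is left, the enhanced cluster is contained in `C`. -/
theorem reach_mem (hH : H.Connected) (h : ExplorationState G H π r N x₀ R T C σ P M)
    (h₁ : ∀ u v, H.Adj u v → u ∈ C → link s(u, v) ∉ R)
    (h₂ : ∀ u ∈ N, mark u ∈ R → u ∈ C → ¬ H.BallOpen r T u) {A : Set (PercItem W)} (hA : A ⊆ R)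
    {v : W} (hv : ReflTransGen (H.EnhArc r N (T ∪ A)) (π x₀) v) : v ∈ C := by
  have hl : ∀ x y, x ∈ C → H.Adj x y → link s(x, y) ∈ T ∪ A → y ∈ C := by
    rintro x y hx hxy (hT | hA')
    · exact (h.links x y hxy hT).2
    · exact absurd (hA hA') (h₁ x y hxy hx)
  refine hv.closed (fun x y hx hxy => ?_) h.root
  rcases hxy with ⟨h3, h4⟩ | ⟨h3, h4, h5, h6⟩
  · exact hl x y hx h3 h4
  · rcases h4 with h4 | h4
    · exact h.marks x h4 y h6
    -- A ball open in `T ∪ A` is contained in `C`, where no edge is unexplored; so it is already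
    -- open in `T`, and its mark would still be testable.
    · refine absurd (fun a b hab ha hb => ?_) (h₂ x h3 (hA h4) hx)
      have haC : a ∈ C := (hH.reflTransGen_distBall ha).closed
        (fun p q hp hpq => hl p q hp hpq.1 (h5 _ _ hpq.1 hpq.2.1 hpq.2.2)) hx
      exact (h5 a b hab ha hb).resolve_right fun h' => h₁ a b hab haC (hA h')

/-- An edge closing a cycle in the explored cluster can be revealed without testing anything on the
cover. -/
theorem coin (h : ExplorationState G H π r N x₀ R T C σ P M) {u v : W}
    (huC : u ∈ C) (hvC : v ∈ C) (hR : link s(u, v) ∈ R) :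
    ExplorationState G H π r N x₀ (R \ {link s(u, v)}) (insert (link s(u, v)) T) C σ P M where
  root := h.root
  lift := h.lift
  links := by
    rintro x y hxy (e | hT)
    · injection e with e
      rcases Sym2.eq_iff.1 e with ⟨rfl, rfl⟩ | ⟨rfl, rfl⟩
      · exact ⟨huC, hvC⟩
      · exact ⟨hvC, huC⟩
    · exact h.links x y hxy hT
  marks := by
    rintro x (e | hT)
    · cases e
    · exact h.marks x hT
  disj := by
    rw [Set.disjoint_insert_right]
    exact ⟨fun h' => h'.2 rfl, h.disj.mono_left Set.sdiff_subset⟩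
  spent := fun f hf => (h.spent f hf).mono Set.sdiff_subset (Set.subset_insert _ _)
    (Set.insert_subset (Or.inr hR) Set.subset_union_left) subset_rfl fun _ _ => rfl

theorem discard (h : ExplorationState G H π r N x₀ R T C σ P M) (i : PercItem W) {M' : Set (Sym2 V)}
    (hM : ∀ f ∈ M', f ∈ M ∨ SpentEdge H π r N (R \ {i}) T C σ f) :
    ExplorationState G H π r N x₀ (R \ {i}) T C σ P M' where
  root := h.root
  lift := h.lift
  links := h.links
  marks := h.marks
  disj := h.disj.mono_left Set.sdiff_subset
  spent := fun f hf => (hM f hf).elim (fun h' => (h.spent f h').mono Set.sdiff_subset subset_rfl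
    Set.subset_union_left subset_rfl fun _ _ => rfl) id

theorem extend_link (h : ExplorationState G H π r N x₀ R T C σ P M) {u v : W} {y : V}
    (huC : u ∈ C) (hvC : v ∉ C) (hR : link s(u, v) ∈ R) (hy : G.Adj (σ u) y) (hyv : π y = v)
    (σ' : W → V) (hσ' : ∀ w ∈ C, σ' w = σ w) (hσv : σ' v = y) :
    ExplorationState G H π r N x₀ (R \ {link s(u, v)}) (insert (link s(u, v)) T) (insert v C)
      σ' (insert s(σ u, y) P) M where
  root := Or.inr h.root
  lift := by
    rintro w (rfl | hw)
    · rw [hσv]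
      exact ⟨hyv, (OpenStep.reach_mono (Set.subset_insert _ _) (h.lift u huC).2).tail
        ⟨hy, Or.inl rfl⟩⟩
    · rw [hσ' w hw]
      exact ⟨(h.lift w hw).1, OpenStep.reach_mono (Set.subset_insert _ _) (h.lift w hw).2⟩
  links := by
    rintro x z hxz (e | hT)
    · injection e with e
      rcases Sym2.eq_iff.1 e with ⟨rfl, rfl⟩ | ⟨rfl, rfl⟩
      · exact ⟨Or.inr huC, Or.inl rfl⟩
      · exact ⟨Or.inl rfl, Or.inr huC⟩
    · exact ⟨Or.inr (h.links x z hxz hT).1, Or.inr (h.links x z hxz hT).2⟩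
  marks := by
    rintro x (e | hT) z hz
    · cases e
    · exact Or.inr (h.marks x hT z hz)
  disj := by
    rw [Set.disjoint_insert_right]
    exact ⟨fun h' => h'.2 rfl, h.disj.mono_left Set.sdiff_subset⟩
  spent := fun f hf => (h.spent f hf).mono Set.sdiff_subset (Set.subset_insert _ _)
    (Set.insert_subset (Or.inr hR) Set.subset_union_left) (Set.subset_insert _ _) hσ'

/-- Freshness of an ordinary step. A closed lift would come from an edge no longer in `R`, and a
failed test never spends an edge leaving its ball from the chosen lift `σ u`. -/
theorem lift_notMem (h : ExplorationState G H π r N x₀ R T C σ P M) {u v : W} {y : V}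
    (huC : u ∈ C) (hvC : v ∉ C) (hR : link s(u, v) ∈ R) (hyv : π y = v) : s(σ u, y) ∉ M := by
  have hπ := (h.lift u huC).1
  intro hf
  rcases h.spent _ hf with ⟨a, b, e, h1, h2, h3, h4, -⟩ | ⟨u', -, -, -, h3, a, b, e, h4, h5⟩
  · rcases Sym2.eq_iff.1 e with ⟨rfl, rfl⟩ | ⟨rfl, rfl⟩
    · rw [hπ, hyv] at h4
      exact h4 hR
    · exact hvC (hyv ▸ h1)
  · rcases Sym2.eq_iff.1 e with ⟨rfl, rfl⟩ | ⟨rfl, rfl⟩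
    · rcases h5 with h5 | ⟨-, h5⟩
      · exact hvC (hyv ▸ h3 _ h5)
      · exact h5 (by rw [hπ])
    · exact hvC (hyv ▸ h3 _ h4)

end ExplorationState

/-- The edges of `G` that are tested around the lift `x` of `u`. -/
def testEdges (G : SimpleGraph V) (H : SimpleGraph W) (π : V → W) (r : ℕ) (C : Set W) (σ : W → V)
    (u : W) : Set (Sym2 V) :=
  {f | ∃ a b, f = s(a, b) ∧ G.dist (σ u) a ≤ 2 * r + 1 ∧ G.dist (σ u) b ≤ 2 * r + 1 ∧
    H.dist u (π a) ≤ r ∧ (H.dist u (π b) ≤ r ∨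
      (H.dist u (π b) ≤ r + 1 ∧ π b ∉ C ∧ a ≠ σ (π a)))}

theorem exists_finset_testEdges (hG : G.Connected) (hlf : ∀ v, (G.neighborSet v).Finite) {k : ℕ}
    (hk : ∀ x, (G.distBall x (2 * r + 1)).ncard ≤ k) (C : Set W) (σ : W → V) (u : W) :
    ∃ F : Finset (Sym2 V), (F : Set (Sym2 V)) = testEdges G H π r C σ u ∧ F.card ≤ k ^ 2 := by
  classical
  have hfin := hG.finite_distBall hlf (σ u) (2 * r + 1)
  set B := hfin.toFinset with hB
  have hBc : B.card ≤ k := by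
    rw [hB, ← Set.ncard_eq_toFinset_card _ hfin]
    exact hk _
  have hmem : ∀ x, x ∈ B ↔ G.dist (σ u) x ≤ 2 * r + 1 := fun x => by
    rw [hB, Set.Finite.mem_toFinset]; exact Iff.rfl
  set I : Finset (Sym2 V) := (B ×ˢ B).image fun q => s(q.1, q.2) with hI
  have hsub : testEdges G H π r C σ u ⊆ I := by
    rintro f ⟨a, b, rfl, ha, hb, -⟩
    exact Finset.mem_image.2 ⟨(a, b), Finset.mem_product.2 ⟨(hmem _).2 ha, (hmem _).2 hb⟩, rfl⟩
  refine ⟨(I.finite_toSet.subset hsub).toFinset, Set.Finite.coe_toFinset _, ?_⟩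
  have h1 : (I.finite_toSet.subset hsub).toFinset.card ≤ I.card := Finset.card_le_card (by simpa)
  have h2 : I.card ≤ (B ×ˢ B).card := Finset.card_image_le
  rw [Finset.card_product] at h2
  have h3 : B.card * B.card ≤ k ^ 2 := by
    rw [sq]; exact Nat.mul_le_mul hBc hBc
  omega

/-- Every vertex of an `r`-ball has two lifts that are joined above the ball to a given lift of its
centre. -/
def HasTwoLifts (G : SimpleGraph V) (H : SimpleGraph W) (π : V → W) (r : ℕ) : Prop :=
  ∀ (x : V) (w : W), H.dist (π x) w ≤ r → ∃ w₁ w₂, w₁ ≠ w₂ ∧ ∀ w' ∈ ({w₁, w₂} : Set V), π w' = w ∧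
    ReflTransGen (fun a b => G.Adj a b ∧ (H.dist (π x) (π a) ≤ r ∧ G.dist x a ≤ 2 * r) ∧
      (H.dist (π x) (π b) ≤ r ∧ G.dist x b ≤ 2 * r)) x w'

namespace ExplorationState

variable {N : Set W} {x₀ : V} {R T : Set (PercItem W)} {C : Set W} {σ : W → V}
  {P M : Set (Sym2 V)}

/-- Freshness of a test. Edges spent by ordinary steps project to edges not open and start at chosen
lifts, whereas tested edges lie above an open ball or leave it towards unexplored vertices from
other lifts. Earlier tests are too far away by `hN`. -/
theorem disjoint_testEdges (hH : H.Connected) (h : ExplorationState G H π r N x₀ R T C σ P M)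
    (hN : ∀ u ∈ N, ∀ v ∈ N, u ≠ v → 2 * r + 2 < H.dist u v) {u : W} (huN : u ∈ N)
    (huR : mark u ∈ R) (hb : H.BallOpen r T u) : Disjoint (testEdges G H π r C σ u) M := by
  rw [Set.disjoint_left]
  rintro f ⟨a, b, rfl, -, -, h1, h2⟩ hf
  rcases h.spent _ hf with ⟨a', b', e, g1, g2, g3, -, g4⟩ | ⟨u', hu', g1, -, -, a', b', e, g2, g3⟩
  · rcases Sym2.eq_iff.1 e with ⟨rfl, rfl⟩ | ⟨rfl, rfl⟩
    · rcases h2 with h2 | ⟨-, -, h2⟩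
      · exact g4 (hb _ _ g3 h1 h2)
      · exact h2 g2
    · rcases h2 with h2 | ⟨-, h2, -⟩
      · exact g4 (hb _ _ g3 h2 h1)
      · exact h2 g1
  · have hne : u ≠ u' := fun h' => g1 (h' ▸ huR)
    have hd := hN u huN u' hu' hne
    have t1 := hH.dist_triangle (u := u) (v := π a) (w := u')
    rw [H.dist_comm (u := π a)] at t1
    rcases Sym2.eq_iff.1 e with ⟨rfl, rfl⟩ | ⟨rfl, rfl⟩ <;> omega

/-- Such a `v` is at distance exactly `r + 1`. Of the two lifts of a neighbour `w` on the
`r`-sphere, one differs from `σ w`; go there above the ball, then step out. The last step explains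
the radius `2 * r + 1` in `testEdges`. -/
theorem exists_lift_of_test (hG : G.Connected) (hH : H.Connected)
    (hlift : ∀ x v, H.Adj (π x) v → ∃ y, G.Adj x y ∧ π y = v) (htwo : HasTwoLifts G H π r)
    (h : ExplorationState G H π r N x₀ R T C σ P M) {u : W} (huC : u ∈ C)
    (hb : H.BallOpen r T u) {v : W} (hv : H.dist u v ≤ r + 1) (hvC : v ∉ C) :
    ∃ y, π y = v ∧ ReflTransGen (OpenStep G (P ∪ testEdges G H π r C σ u)) x₀ y := by
  have hball := h.ball_subset hH huC hb
  have hπu := (h.lift u huC).1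
  obtain ⟨w, hwv, hw⟩ := hH.exists_adj_of_dist_succ (x := u) (y := v) (n := r)
    (le_antisymm hv (not_le.1 fun h' => hvC (hball v h')))
  obtain ⟨w', hw'σ, hw'w, hpath⟩ : ∃ w', w' ≠ σ w ∧ π w' = w ∧
      ReflTransGen (fun a b => G.Adj a b ∧ (H.dist (π (σ u)) (π a) ≤ r ∧ G.dist (σ u) a ≤ 2 * r) ∧
      (H.dist (π (σ u)) (π b) ≤ r ∧ G.dist (σ u) b ≤ 2 * r)) (σ u) w' := by
    obtain ⟨w₁, w₂, hne, hw'⟩ := htwo (σ u) w (by rw [hπu]; exact hw.le)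
    by_cases e : w₁ = σ w
    · exact ⟨w₂, fun e' => hne (e.trans e'.symm), hw' w₂ (by simp)⟩
    · exact ⟨w₁, e, hw' w₁ (by simp)⟩
  rw [hπu] at hpath
  obtain ⟨y, hy, hyv⟩ := hlift w' v (by rw [hw'w]; exact hwv)
  have hdw : G.dist (σ u) w' ≤ 2 * r :=
    hpath.closed (S := {a | G.dist (σ u) a ≤ 2 * r}) (fun _ _ _ h => h.2.2.2) (by simp)
  have hdy := hG.dist_le_succ (x := σ u) hy
  refine ⟨y, hyv, ((OpenStep.reach_mono Set.subset_union_left (h.lift u huC).2).trans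
    (ReflTransGen.mono (fun a b hab => ?_) _ _ hpath)).tail ⟨hy, Or.inr ?_⟩⟩
  · exact ⟨hab.1, Or.inr ⟨a, b, rfl, by omega, by omega, hab.2.1.1, Or.inl hab.2.2.1⟩⟩
  · refine ⟨w', y, rfl, by omega, by omega, by rw [hw'w]; exact hw.le, Or.inr ?_⟩
    rw [hyv, hw'w]
    exact ⟨hv, hvC, hw'σ⟩

theorem extend_mark (h : ExplorationState G H π r N x₀ R T C σ P M) {u : W}
    (huR : mark u ∈ R) {F : Set (Sym2 V)} {y : W → V}
    (hy : ∀ v, H.dist u v ≤ r + 1 → v ∉ C → π (y v) = v ∧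
      ReflTransGen (OpenStep G (P ∪ F)) x₀ (y v)) (σ' : W → V) (hσ' : ∀ w ∈ C, σ' w = σ w)
    (hσy : ∀ w, w ∉ C → σ' w = y w) :
    ExplorationState G H π r N x₀ (R \ {mark u}) (insert (mark u) T)
      (C ∪ {v | H.dist u v ≤ r + 1}) σ' (P ∪ F) M where
  root := Or.inl h.root
  lift := by
    intro w hw
    by_cases hwC : w ∈ C
    · rw [hσ' w hwC]
      exact ⟨(h.lift w hwC).1, OpenStep.reach_mono Set.subset_union_left (h.lift w hwC).2⟩
    · rw [hσy w hwC]
      exact hy w (hw.resolve_left hwC) hwC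
  links := by
    rintro x z hxz (e | hT)
    · cases e
    · exact ⟨Or.inl (h.links x z hxz hT).1, Or.inl (h.links x z hxz hT).2⟩
  marks := by
    rintro x (e | hT) z hz
    · injection e with e
      exact Or.inr (e ▸ hz)
    · exact Or.inl (h.marks x hT z hz)
  disj := by
    rw [Set.disjoint_insert_right]
    exact ⟨fun h' => h'.2 rfl, h.disj.mono_left Set.sdiff_subset⟩
  spent := fun f hf => (h.spent f hf).mono Set.sdiff_subset (Set.subset_insert _ _)
    (Set.insert_subset (Or.inr huR) Set.subset_union_left) Set.subset_union_left hσ'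

theorem spentEdge_of_testEdges (hH : H.Connected) (h : ExplorationState G H π r N x₀ R T C σ P M)
    {u : W} (huN : u ∈ N) (huC : u ∈ C) (hb : H.BallOpen r T u) {f : Sym2 V}
    (hf : f ∈ testEdges G H π r C σ u) : SpentEdge H π r N (R \ {mark u}) T C σ f := by
  obtain ⟨a, b, rfl, -, -, h1, h2⟩ := hf
  exact Or.inr ⟨u, huN, fun h' => h'.2 rfl, hb, h.ball_subset hH huC hb, a, b, rfl, h1,
    h2.imp_right fun h2 => ⟨h2.1, h2.2.2⟩⟩

end ExplorationState

end SimpleGraph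

/-! ### Domination of the enhanced model by percolation on the cover -/

namespace SimpleGraph

open PercItem Relation Filter

variable {V W : Type*} {G : SimpleGraph V} {H : SimpleGraph W} {π : V → W} {r : ℕ}

open Classical in
theorem bernoulliExp_union_eq {ι : Type*} {R : Finset ι} {p : ι → ℝ} {i : ι} (hi : i ∈ R)
    (f : Set ι → ℝ) (T : Set ι) :
    bernoulliExp R p (fun A => f (T ∪ A)) =
      p i * bernoulliExp (R.erase i) p (fun A => f (insert i T ∪ A)) +
      (1 - p i) * bernoulliExp (R.erase i) p (fun A => f (T ∪ A)) := by
  conv_lhs => rw [← Finset.insert_erase hi]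
  rw [bernoulliExp.insert (by simp)]
  simp only [Set.union_insert, Set.insert_union]

theorem itemWeight_mem {p s : ℝ} (hp0 : 0 ≤ p) (hp1 : p ≤ 1) (hs0 : 0 ≤ s) (hs1 : s ≤ 1)
    (i : PercItem W) : 0 ≤ itemWeight p s i ∧ itemWeight p s i ≤ 1 := by
  cases i <;> simp only [itemWeight] <;> constructor <;> first | assumption | norm_num

set_option maxHeartbeats 1000000 in
/-- The lifted exploration reaches at least as far as the enhanced exploration. -/
theorem ExplorationState.comparison (hG : G.Connected) (hH : H.Connected)
    (hlf : ∀ v, (G.neighborSet v).Finite)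
    (hlift : ∀ x v, H.Adj (π x) v → ∃ y, G.Adj x y ∧ π y = v) (htwo : HasTwoLifts G H π r) {k : ℕ}
    (hk : ∀ x, (G.distBall x (2 * r + 1)).ncard ≤ k) {p s : ℝ} (hp0 : 0 ≤ p) (hp1 : p ≤ 1)
    (hs0 : 0 ≤ s) (hs : s ≤ p ^ (k ^ 2)) {N : Set W}
    (hN : ∀ u ∈ N, ∀ v ∈ N, u ≠ v → 2 * r + 2 < H.dist u v) {x₀ : V} {n : ℕ} :
    ∀ (m : ℕ) (R : Finset (PercItem W)) (T : Set (PercItem W)) (C : Set W) (σ : W → V)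
      (P M : Set (Sym2 V)), R.card = m → ExplorationState G H π r N x₀ R T C σ P M →
      ∀ᶠ S : Finset (Sym2 V) in atTop,
        bernoulliExp R (itemWeight p s) (fun A => propInd (H.EnhHits r N (π x₀) n (T ∪ A))) ≤
        bernoulliExp S (fun _ => p) (fun A => propInd (CoverHits G H π x₀ n (A \ M ∪ P))) := by
  classical
  have hs1 : s ≤ 1 := hs.trans (pow_le_one₀ hp0 hp1)
  have hw := itemWeight_mem (W := W) hp0 hp1 hs0 hs1
  intro m
  induction m with
  | zero =>
    intro R T C σ P M hR h
    rw [Finset.card_eq_zero] at hR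
    subst hR
    refine Eventually.of_forall fun S => ?_
    rw [bernoulliExp.empty]
    by_cases hh : H.EnhHits r N (π x₀) n (T ∪ ∅)
    · obtain ⟨v, hv, hr⟩ := hh
      have hvC := h.reach_mem hH (by simp) (by simp) (by simp) hr
      refine (propInd_le_one _).trans ?_
      rw [← bernoulliExp.const (S := S) (p := fun _ => p) 1]
      refine bernoulliExp.mono (fun _ _ => hp0) (fun _ _ => hp1) fun A _ => ?_
      rw [propInd_of]
      refine ⟨σ v, by rw [(h.lift v hvC).1]; exact hv,
        OpenStep.reach_mono Set.subset_union_right (h.lift v hvC).2⟩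
    · rw [propInd_of_not hh]
      exact bernoulliExp.nonneg (fun _ _ => hp0) (fun _ _ => hp1) fun A _ => propInd_nonneg _
  | succ m ih =>
    intro R T C σ P M hR h
    have hcard : ∀ i ∈ R, (R.erase i).card = m := fun i hi => by
      rw [Finset.card_erase_of_mem hi, hR]; rfl
    have hco : ∀ i, ((R.erase i : Finset (PercItem W)) : Set (PercItem W)) = ↑R \ {i} := fun i =>
      Finset.coe_erase i R
    by_cases h₁ : ∃ u v, H.Adj u v ∧ u ∈ C ∧ link s(u, v) ∈ R
    · obtain ⟨u, v, huv, huC, hi⟩ := h₁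
      by_cases hvC : v ∈ C
      · -- the edge joins explored vertices
        have k1 := ih (R.erase (link s(u, v))) _ C σ P M (hcard _ hi)
          (by rw [hco]; exact h.coin huC hvC hi)
        have k0 := ih (R.erase (link s(u, v))) T C σ P M (hcard _ hi)
          (by rw [hco]; exact h.discard _ fun f hf => Or.inl hf)
        filter_upwards [k1, k0] with S k1 k0
        rw [bernoulliExp_union_eq hi fun A => propInd (H.EnhHits r N (π x₀) n A)]
        have := hw (link s(u, v))
        nlinarith [mul_le_mul_of_nonneg_left k1 this.1,
          mul_le_mul_of_nonneg_left k0 (sub_nonneg.2 this.2)]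
      · -- the edge leads out of the explored cluster
        obtain ⟨y, hy, hyv⟩ := hlift (σ u) v (by rw [(h.lift u huC).1]; exact huv)
        have hσ' : ∀ w ∈ C, Function.update σ v y w = σ w := fun w hw =>
          Function.update_of_ne (by rintro rfl; exact hvC hw) _ _
        have hnM := h.lift_notMem huC hvC hi hyv
        have k1 := ih (R.erase (link s(u, v))) _ _ _ _ M (hcard _ hi)
          (by rw [hco]; exact h.extend_link huC hvC hi hy hyv _ hσ' (Function.update_self _ _ _))
        have k0 := ih (R.erase (link s(u, v))) T C σ P (insert s(σ u, y) M) (hcard _ hi)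
          (by
            rw [hco]
            refine h.discard _ ?_
            rintro f (rfl | hf)
            · have hπ := (h.lift u huC).1
              refine Or.inr (Or.inl ⟨σ u, y, rfl, by rwa [hπ], by rw [hπ],
                by rw [hπ, hyv]; exact huv, ?_, ?_⟩)
              · rw [hπ, hyv]; exact fun h' => h'.2 rfl
              · rw [hπ, hyv]; exact Set.disjoint_left.1 h.disj hi
            · exact Or.inl hf)
        -- The lifted edge and the explored edge have the same parameter `p`, so the two conditional
        -- expansions match term by term.
        filter_upwards [k1, k0, eventually_ge_atTop {s(σ u, y)}] with S k1 k0 hS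
        have hfS : s(σ u, y) ∈ S := hS (Finset.mem_singleton_self _)
        rw [bernoulliExp_union_eq hi fun A => propInd (H.EnhHits r N (π x₀) n A),
          bernoulliExp.cond hfS]
        have e1 : ∀ A : Set (Sym2 V), insert s(σ u, y) A \ M ∪ P =
            A \ M ∪ insert s(σ u, y) P := fun A => by
          rw [Set.insert_sdiff_of_notMem _ hnM, Set.insert_union, Set.union_insert]
        have e0 : ∀ A : Set (Sym2 V), (A \ {s(σ u, y)}) \ M ∪ P =
            A \ insert s(σ u, y) M ∪ P := fun A => by
          rw [Set.sdiff_sdiff, Set.singleton_union]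
        simp only [e1, e0]
        exact add_le_add (mul_le_mul_of_nonneg_left k1 hp0)
          (mul_le_mul_of_nonneg_left k0 (sub_nonneg.2 hp1))
    · by_cases h₂ : ∃ u ∈ N, mark u ∈ R ∧ u ∈ C ∧ H.BallOpen r T u
      · -- test the surroundings of a vertex
        obtain ⟨u, huN, hi, huC, hb⟩ := h₂
        obtain ⟨F, hF, hFk⟩ := exists_finset_testEdges (H := H) (π := π) hG hlf hk C σ u
        have hdis := h.disjoint_testEdges hH hN huN hi hb
        have hex : ∀ v, ∃ y, H.dist u v ≤ r + 1 → v ∉ C → π y = v ∧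
            ReflTransGen (OpenStep G (P ∪ testEdges G H π r C σ u)) x₀ y := by
          intro v
          by_cases hv : H.dist u v ≤ r + 1 ∧ v ∉ C
          · obtain ⟨y, hy⟩ := h.exists_lift_of_test hG hH hlift htwo huC hb hv.1 hv.2
            exact ⟨y, fun _ _ => hy⟩
          · exact ⟨x₀, fun h1 h2 => absurd ⟨h1, h2⟩ hv⟩
        choose y hy using hex
        rw [← hF] at hy hdis
        have k1 := ih (R.erase (mark u)) _ _ _ _ M (hcard _ hi)
          (by
            rw [hco]
            exact h.extend_mark hi hy (fun w => if w ∈ C then σ w else y w)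
              (fun w hw => if_pos hw) (fun w hw => if_neg hw))
        have k0 := ih (R.erase (mark u)) T C σ P (F ∪ M) (hcard _ hi)
          (by
            rw [hco]
            refine h.discard _ ?_
            rintro f (hf | hf)
            · rw [hF] at hf
              exact Or.inr (h.spentEdge_of_testEdges hH huN huC hb hf)
            · exact Or.inl hf)
        filter_upwards [k1, k0, eventually_ge_atTop F] with S k1 k0 hS
        rw [bernoulliExp_union_eq hi fun A => propInd (H.EnhHits r N (π x₀) n A)]
        have key := bernoulliExp.test_le (S := S) (p := fun _ => p) (fun _ _ => hp0)
          (fun _ _ => hp1) p F hS (fun _ _ => rfl)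
          (fun A => propInd (CoverHits G H π x₀ n (A \ M ∪ P)))
          (fun A B hAB => propInd_mono fun h' => h'.mono
            (Set.union_subset_union_left _ (Set.sdiff_subset_sdiff_left hAB)))
        have e1 : ∀ A : Set (Sym2 V), (A ∪ F) \ M ∪ P = A \ M ∪ (P ∪ F) := fun A => by
          rw [Set.union_sdiff_distrib, hdis.sdiff_eq_left, Set.union_assoc,
            Set.union_comm (F : Set (Sym2 V)) P]
        have e0 : ∀ A : Set (Sym2 V), (A \ F) \ M ∪ P = A \ (F ∪ M) ∪ P := fun A => by
          rw [Set.sdiff_sdiff]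
        simp only [e1, e0] at key
        refine le_trans ?_ key
        -- The test succeeds at least as often as the mark is present, and by `hle` success is at
        -- least as good as failure; the surplus success is given away.
        have hsF : s ≤ p ^ F.card := hs.trans (pow_le_pow_of_le_one hp0 hp1 hFk)
        have hle : bernoulliExp S (fun _ => p)
              (fun A => propInd (CoverHits G H π x₀ n (A \ (F ∪ M) ∪ P))) ≤
            bernoulliExp S (fun _ => p)
              (fun A => propInd (CoverHits G H π x₀ n (A \ M ∪ (P ∪ F)))) :=
          bernoulliExp.mono (fun _ _ => hp0) (fun _ _ => hp1) fun A _ => propInd_mono fun h' =>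
            h'.mono (Set.union_subset_union
              (Set.sdiff_subset_sdiff_right Set.subset_union_right) Set.subset_union_left)
        have e : itemWeight p s (mark u) = s := rfl
        rw [e]
        have a1 := mul_le_mul_of_nonneg_left k1 hs0
        have a0 := mul_le_mul_of_nonneg_left k0 (sub_nonneg.2 hs1)
        have a2 := mul_le_mul_of_nonneg_left hle (sub_nonneg.2 hsF)
        nlinarith
      · -- nothing is left to explore
        push Not at h₁ h₂
        have hmem : ∀ A : Set (PercItem W), A ⊆ R → ∀ v,
            ReflTransGen (H.EnhArc r N (T ∪ A)) (π x₀) v → v ∈ C := fun A hA v hv =>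
          h.reach_mem hH (fun a b hab ha => h₁ a b hab ha) (fun a ha hb hc => h₂ a ha hb hc) hA hv
        refine Eventually.of_forall fun S => ?_
        by_cases hh : ∃ v ∈ C, n ≤ H.dist (π x₀) v
        · obtain ⟨v, hvC, hv⟩ := hh
          have e1 : bernoulliExp S (fun _ => p)
              (fun A => propInd (CoverHits G H π x₀ n (A \ M ∪ P))) = 1 := by
            rw [← bernoulliExp.const (S := S) (p := fun _ => p) 1]
            refine bernoulliExp.congr fun A _ => propInd_of ?_
            exact ⟨σ v, by rw [(h.lift v hvC).1]; exact hv,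
              OpenStep.reach_mono Set.subset_union_right (h.lift v hvC).2⟩
          rw [e1, ← bernoulliExp.const (S := R) (p := itemWeight p s) 1]
          exact bernoulliExp.mono (fun i _ => (hw i).1) (fun i _ => (hw i).2) fun A _ =>
            propInd_le_one _
        · have e0 : bernoulliExp R (itemWeight p s)
              (fun A => propInd (H.EnhHits r N (π x₀) n (T ∪ A))) = 0 := by
            rw [← bernoulliExp.const (S := R) (p := itemWeight p s) 0]
            refine bernoulliExp.congr fun A hA => propInd_of_not ?_
            rintro ⟨v, hv, hr⟩
            exact hh ⟨v, hmem A hA v hr, hv⟩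
          rw [e0]
          exact bernoulliExp.nonneg (fun _ _ => hp0) (fun _ _ => hp1) fun A _ => propInd_nonneg _

/-- Percolation on the cover reaches at least as far as the enhanced model on the quotient. -/
theorem seedHits_le_coverHits (hG : G.Connected) (hH : H.Connected)
    (hlf : ∀ v, (G.neighborSet v).Finite)
    (hlift : ∀ x v, H.Adj (π x) v → ∃ y, G.Adj x y ∧ π y = v) (htwo : HasTwoLifts G H π r) {k : ℕ}
    (hk : ∀ x, (G.distBall x (2 * r + 1)).ncard ≤ k) {p s : ℝ} (hp0 : 0 ≤ p) (hp1 : p ≤ 1)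
    (hs0 : 0 ≤ s) (hs : s ≤ p ^ (k ^ 2)) (x₀ : V) (n : ℕ) (I : Finset (PercItem W)) :
    ∃ S : Finset (Sym2 V),
      bernoulliExp I (itemWeight p s) (fun T => propInd (H.SeedHits r (π x₀) n T)) ≤
      bernoulliExp S (fun _ => p) (fun A => propInd (CoverHits G H π x₀ n A)) := by
  classical
  have hs1 : s ≤ 1 := hs.trans (pow_le_one₀ hp0 hp1)
  have hw := itemWeight_mem (W := W) hp0 hp1 hs0 hs1
  -- Seeds are revealed first. This fixes the set of eligible vertices, whose mutual distances
  -- exceed `2 * r + 2`.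
  set B := I.filter fun i => ∃ u, i = seed u with hB
  set I' := I.filter fun i => ¬ ∃ u, i = seed u with hI'
  have hdis : Disjoint B I' := Finset.disjoint_filter_filter_not _ _ _
  have hun : B ∪ I' = I := Finset.filter_union_filter_not_eq _ _
  have key : ∀ A ∈ B.powerset, ∀ᶠ S : Finset (Sym2 V) in atTop,
      bernoulliExp I' (itemWeight p s) (fun T => propInd (H.SeedHits r (π x₀) n (T ∪ A))) ≤
      bernoulliExp S (fun _ => p) (fun A => propInd (CoverHits G H π x₀ n A)) := by
    intro A hA
    rw [Finset.mem_powerset] at hA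
    have hAs : ∀ i ∈ A, ∃ u, i = seed u := fun i hi => (Finset.mem_filter.1 (hA hi)).2
    have hcmp := ExplorationState.comparison hG hH hlf hlift htwo hk hp0 hp1 hs0 hs
      (N := {u | H.IsEligible r A u}) (x₀ := x₀) (n := n)
      (fun u hu v hv huv => by
        by_contra hc
        exact hu.2 v huv.symm (not_lt.1 hc) hv.1)
      I'.card I' A {π x₀} (fun _ => x₀) ∅ ∅ rfl
      { root := rfl
        lift := by rintro w rfl; exact ⟨rfl, .refl⟩
        links := fun u v _ h => by obtain ⟨_, h'⟩ := hAs _ h; cases h'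
        marks := fun u h => by obtain ⟨_, h'⟩ := hAs _ h; cases h'
        disj := by
          rw [Finset.disjoint_coe]
          exact (hdis.mono_left hA).symm
        spent := fun f hf => absurd hf (Set.notMem_empty f) }
    filter_upwards [hcmp] with S hS
    simp only [Set.sdiff_empty, Set.union_empty] at hS
    refine le_of_eq_of_le (bernoulliExp.congr fun T hT => ?_) hS
    have : {u | H.IsEligible r (T ∪ A) u} = {u | H.IsEligible r A u} := by
      have hsd : ∀ u, seed u ∈ T ∪ A ↔ seed u ∈ (A : Set (PercItem W)) := fun u => by
        refine ⟨fun h => h.resolve_left fun h' => ?_, Or.inr⟩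
        exact (Finset.mem_filter.1 (hT h')).2 ⟨u, rfl⟩
      ext u
      simp only [IsEligible, hsd]
    rw [SeedHits, this, Set.union_comm]
  obtain ⟨S, hS⟩ := ((eventually_all_finset B.powerset).2 key).exists
  refine ⟨S, ?_⟩
  rw [← hun]
  exact bernoulliExp.le_of_forall_union hdis (fun i _ => (hw i).1) (fun i _ => (hw i).2)
    fun A hA => hS A (Finset.mem_powerset.2 hA)

end SimpleGraph

/-! ### Cylinder events of Bernoulli percolation -/

theorem bernoulliExp.map {ι κ : Type*} (e : ι ↪ κ) (S : Finset ι) (p : κ → ℝ) (f : Set κ → ℝ) :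
    bernoulliExp (S.map e) p f = bernoulliExp S (fun i => p (e i)) (fun T => f (e '' T)) := by
  classical
  induction S using Finset.induction_on generalizing f with
  | empty => simp [bernoulliExp.empty]
  | insert i S hi ih =>
    rw [Finset.map_insert, bernoulliExp.insert (by simpa using hi), bernoulliExp.insert hi, ih, ih]
    simp only [Set.image_insert_eq]

theorem infinitePi_bernoulli_cylinder {ι : Type*} (p : unitInterval) (S : Finset ι)
    (Y : Set ι → Prop) :
    Measure.infinitePi (fun _ : ι => bernoulliMeasure true false p)
      {ω | Y {i | i ∈ S ∧ ω i = true}} =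
    ENNReal.ofReal (bernoulliExp S (fun _ => (p : ℝ)) (fun T => propInd (Y T))) := by
  classical
  have hp0 : (0 : ℝ) ≤ p := p.2.1
  have hp1 : (p : ℝ) ≤ 1 := p.2.2
  set B : Finset ι → Set (ι → Bool) := fun T =>
    Set.pi S (fun i => if i ∈ T then {true} else {false}) with hB
  have hBmem : ∀ T : Finset ι, T ⊆ S → ∀ ω, ω ∈ B T ↔ {i | i ∈ S ∧ ω i = true} = ↑T := by
    intro T hT ω
    simp only [hB, Set.mem_pi, Finset.mem_coe]
    constructor
    · intro h
      ext i
      constructor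
      · rintro ⟨hi, hω⟩
        by_contra hc
        have := h i hi
        rw [if_neg (by simpa using hc)] at this
        simp [hω] at this
      · intro hi
        have hi' : i ∈ T := by simpa using hi
        have := h i (hT hi')
        rw [if_pos hi'] at this
        exact ⟨hT hi', this⟩
    · intro h i hi
      by_cases hiT : i ∈ T
      · have : i ∈ {i | i ∈ S ∧ ω i = true} := h ▸ (Finset.mem_coe.2 hiT)
        rw [if_pos hiT]
        exact this.2
      · rw [if_neg hiT]
        have : i ∉ {i | i ∈ S ∧ ω i = true} := by rw [h]; simpa using hiT
        simpa [hi] using this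
  have hset : {ω : ι → Bool | Y {i | i ∈ S ∧ ω i = true}} =
      ⋃ T ∈ S.powerset.filter fun T : Finset ι => Y ↑T, B T := by
    ext ω
    simp only [Set.mem_iUnion, Finset.mem_filter, Finset.mem_powerset, exists_prop]
    constructor
    · intro h
      have hc : ((S.filter fun i => ω i = true : Finset ι) : Set ι) =
          {i | i ∈ S ∧ ω i = true} := by ext i; simp
      refine ⟨S.filter fun i => ω i = true, ⟨Finset.filter_subset _ _, ?_⟩, ?_⟩
      · rw [hc]; exact h
      · rw [hBmem _ (Finset.filter_subset _ _), hc]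
    · rintro ⟨T, ⟨hT, hY⟩, hω⟩
      rw [hBmem T hT] at hω
      change Y _
      rw [hω]
      exact hY
  have hmeas : ∀ T : Finset ι, MeasurableSet (B T) := fun T =>
    MeasurableSet.pi S.countable_toSet fun i _ => MeasurableSet.of_discrete
  have hval : ∀ T ⊆ S, Measure.infinitePi (fun _ : ι => bernoulliMeasure true false p) (B T) =
      ENNReal.ofReal ((∏ i ∈ T, (p : ℝ)) * ∏ i ∈ S \ T, (1 - (p : ℝ))) := by
    intro T hT
    rw [hB, Measure.infinitePi_pi _ fun i _ => MeasurableSet.of_discrete]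
    have e1 : ∀ i, bernoulliMeasure true false p (if i ∈ T then {true} else {false}) =
        ENNReal.ofReal (if i ∈ T then (p : ℝ) else 1 - p) := by
      intro i
      split_ifs
      · rw [bernoulliMeasure_apply p MeasurableSet.of_discrete]
        simp [ENNReal.ofReal, unitInterval.toNNReal, Real.toNNReal_of_nonneg hp0]
        rfl
      · rw [bernoulliMeasure_apply p MeasurableSet.of_discrete]
        simp [ENNReal.ofReal, unitInterval.toNNReal, Real.toNNReal_of_nonneg (sub_nonneg.2 hp1)]
        rfl
    simp only [e1]
    rw [← ENNReal.ofReal_prod_of_nonneg fun i _ => by split_ifs <;> linarith]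
    congr 1
    rw [← Finset.prod_sdiff hT, mul_comm]
    congr 1
    · exact Finset.prod_congr rfl fun i hi => if_pos hi
    · exact Finset.prod_congr rfl fun i hi => if_neg (Finset.mem_sdiff.1 hi).2
  rw [hset, measure_biUnion_finset _ fun T _ => hmeas T]
  · rw [Finset.sum_congr rfl fun T hT =>
      hval T (Finset.mem_powerset.1 (Finset.mem_filter.1 hT).1),
      ← ENNReal.ofReal_sum_of_nonneg]
    · congr 1
      unfold bernoulliExp
      rw [Finset.sum_filter]
      refine Finset.sum_congr rfl fun T _ => ?_
      beta_reduce
      split_ifs with h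
      · rw [propInd_of h, mul_one]
      · rw [propInd_of_not h, mul_zero]
    · intro T _
      exact mul_nonneg (Finset.prod_nonneg fun _ _ => hp0)
        (Finset.prod_nonneg fun _ _ => sub_nonneg.2 hp1)
  · intro T hT T' hT' hne
    refine Set.disjoint_left.2 fun ω h h' => hne ?_
    rw [Finset.mem_coe, Finset.mem_filter, Finset.mem_powerset] at hT hT'
    have h1 := (hBmem T hT.1 ω).1 h
    have h2 := (hBmem T' hT'.1 ω).1 h'
    exact Finset.coe_injective (h1.symm.trans h2)

/-! ### From finite products to the percolation measure -/

namespace SimpleGraph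

open PercItem Relation Filter

variable {V W : Type*} {G : SimpleGraph V} {H : SimpleGraph W} {π : V → W}

instance (G : SimpleGraph V) (p : unitInterval) : IsProbabilityMeasure (G.bondPercolation p) := by
  unfold bondPercolation
  infer_instance

/-- The set of open edges of a configuration. -/
def openEdges (G : SimpleGraph V) (ω : G.edgeSet → Bool) : Set (Sym2 V) :=
  {e | ∃ h : e ∈ G.edgeSet, ω ⟨e, h⟩ = true}

theorem bondPercolation_cylinder (p : unitInterval) (S : Finset (Sym2 V))
    (hS : (S : Set (Sym2 V)) ⊆ G.edgeSet) (Y : Set (Sym2 V) → Prop) :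
    G.bondPercolation p {ω | Y (G.openEdges ω ∩ S)} =
      ENNReal.ofReal (bernoulliExp S (fun _ => (p : ℝ)) (fun T => propInd (Y T))) := by
  classical
  set S' : Finset G.edgeSet := S.subtype (· ∈ G.edgeSet) with hS'
  have hmap : S'.map (Function.Embedding.subtype _) = S := by
    rw [hS', Finset.subtype_map]
    exact Finset.filter_true_of_mem fun e he => hS he
  rw [← hmap, bernoulliExp.map, hmap]
  refine Eq.trans ?_ (infinitePi_bernoulli_cylinder p S' fun T => Y (Subtype.val '' T))
  unfold bondPercolation
  congr 1
  ext ω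
  have : G.openEdges ω ∩ S = Subtype.val '' {i : G.edgeSet | i ∈ S' ∧ ω i = true} := by
    ext e
    constructor
    · rintro ⟨⟨he, hω⟩, heS⟩
      exact ⟨⟨e, he⟩, ⟨by rw [hS', Finset.mem_subtype]; exact heS, hω⟩, rfl⟩
    · rintro ⟨⟨e, he⟩, ⟨h1, h2⟩, rfl⟩
      rw [hS', Finset.mem_subtype] at h1
      exact ⟨⟨he, h2⟩, h1⟩
  change Y _ ↔ Y _
  rw [this]

theorem reachable_openSubgraph_iff {ω : G.edgeSet → Bool} {x y : V} :
    (G.openSubgraph ω).Reachable x y ↔ ReflTransGen (OpenStep G (G.openEdges ω)) x y := by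
  rw [reachable_iff_reflTransGen]
  have : (G.openSubgraph ω).Adj = OpenStep G (G.openEdges ω) := by
    funext a b
    exact propext ⟨fun ⟨h, hω⟩ => ⟨h, h, hω⟩, fun ⟨h, h', hω⟩ => ⟨h, hω⟩⟩
  rw [this]

/-- The set `S` may contain pairs that are not edges; `OpenStep` ignores them, so they are dropped
before passing to a cylinder event. -/
theorem coverHits_le_bondPercolation (p : unitInterval) (x₀ : V) (n : ℕ) (S : Finset (Sym2 V)) :
    ENNReal.ofReal (bernoulliExp S (fun _ => (p : ℝ)) (fun A => propInd (CoverHits G H π x₀ n A))) ≤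
      G.bondPercolation p {ω | CoverHits G H π x₀ n (G.openEdges ω)} := by
  classical
  set S' := S.filter (· ∈ G.edgeSet) with hS'
  have h1 : bernoulliExp S (fun _ => (p : ℝ)) (fun A => propInd (CoverHits G H π x₀ n A)) ≤
      bernoulliExp S (fun _ => (p : ℝ))
        (fun A => (fun A => propInd (CoverHits G H π x₀ n A)) (A ∩ S')) := by
    refine bernoulliExp.mono (fun _ _ => p.2.1) (fun _ _ => p.2.2) fun A hA => propInd_mono ?_
    rintro ⟨y, hy, hr⟩
    exact ⟨y, hy, ReflTransGen.mono (fun a b hab => ⟨hab.1, hab.2,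
      Finset.mem_coe.2 (Finset.mem_filter.2 ⟨hA hab.2, hab.1⟩)⟩) _ _ hr⟩
  rw [bernoulliExp.inter_eq (f := fun A => propInd (CoverHits G H π x₀ n A))
    (Finset.filter_subset _ _)] at h1
  refine (ENNReal.ofReal_le_ofReal h1).trans ?_
  rw [← bondPercolation_cylinder p S' fun e he => (Finset.mem_filter.1 he).2]
  exact measure_mono fun ω h => CoverHits.mono h Set.inter_subset_left

/-- The edges of a ball. -/
def ballEdges (H : SimpleGraph W) (o : W) (n : ℕ) : Set (Sym2 W) :=
  {e | link e ∈ H.itemBox o n}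

theorem finite_ballEdges (hH : H.Connected) (hlf : ∀ v, (H.neighborSet v).Finite) (o : W) (n : ℕ) :
    (H.ballEdges o n).Finite :=
  (finite_itemBox hH hlf o n).preimage fun _ _ _ _ h => by injection h

theorem bondPercolation_le_ballEdges (hH : H.Connected) (hlf : ∀ v, (H.neighborSet v).Finite)
    (p : unitInterval) (o : W) (n : ℕ) :
    H.bondPercolation p {ω | CoverHits H H id o n (H.openEdges ω)} ≤
      ENNReal.ofReal (bernoulliExp (finite_ballEdges hH hlf o n).toFinset (fun _ => (p : ℝ))
        (fun A => propInd (CoverHits H H id o n A))) := by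
  rw [← bondPercolation_cylinder]
  · refine measure_mono ?_
    rintro ω ⟨v, hv, hov⟩
    obtain ⟨c, hc, hoc⟩ := hov.exists_first_hit (P := fun v => n ≤ H.dist o v) hv
    refine ⟨c, hc, ReflTransGen.mono ?_ _ _ hoc⟩
    rintro x y ⟨hxy, hx⟩
    refine ⟨hxy.1, hxy.2, ?_⟩
    rw [Set.Finite.coe_toFinset]
    have := hH.dist_le_succ (x := o) hxy.1
    exact link_mem_itemBox_iff.2 ⟨hxy.1, by omega, by omega⟩
  · rw [Set.Finite.coe_toFinset]
    intro e
    induction e using Sym2.ind with | h x y => ?_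
    exact fun he => (link_mem_itemBox_iff.1 he).1

theorem ballEdges_le_seedHits (hH : H.Connected) (hlf : ∀ v, (H.neighborSet v).Finite)
    {p : ℝ} (hp0 : 0 ≤ p) (hp1 : p ≤ 1) (r : ℕ) (o : W) (n : ℕ) :
    bernoulliExp (finite_ballEdges hH hlf o n).toFinset (fun _ => p)
        (fun A => propInd (CoverHits H H id o n A)) ≤
      bernoulliExp (finite_itemBox hH hlf o n).toFinset (itemWeight p 0)
        (fun T => propInd (H.SeedHits r o n T)) := by
  classical
  set L : Sym2 W ↪ PercItem W := ⟨link, fun _ _ h => by injection h⟩ with hL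
  set f : Set (PercItem W) → ℝ := fun T => propInd (CoverHits H H id o n {e | link e ∈ T}) with hf
  have hw := itemWeight_mem (W := W) hp0 hp1 le_rfl zero_le_one
  have e1 : bernoulliExp (finite_ballEdges hH hlf o n).toFinset (fun _ => p)
      (fun A => propInd (CoverHits H H id o n A)) =
      bernoulliExp ((finite_ballEdges hH hlf o n).toFinset.map L) (itemWeight p 0) f := by
    rw [bernoulliExp.map]
    refine bernoulliExp.congr fun A _ => ?_
    simp only [hf]
    congr 2
    ext e
    refine ⟨fun h => ⟨e, h, rfl⟩, fun ⟨e', he', h⟩ => ?_⟩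
    exact L.injective h ▸ he'
  have hsub : (finite_ballEdges hH hlf o n).toFinset.map L ⊆
      (finite_itemBox hH hlf o n).toFinset := by
    intro i hi
    obtain ⟨e, he, rfl⟩ := Finset.mem_map.1 hi
    rw [Set.Finite.mem_toFinset] at he ⊢
    exact he
  rw [e1, ← bernoulliExp.inter_eq hsub]
  refine bernoulliExp.mono (fun i _ => (hw i).1) (fun i _ => (hw i).2) fun T _ => propInd_mono ?_
  rintro ⟨v, hv, hr⟩
  exact ⟨v, hv, ReflTransGen.mono (fun a b hab => Or.inl ⟨hab.1, hab.2.1⟩) _ _ hr⟩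

/-! ### Infinite clusters -/

/-- A path uses finitely many edges, so the event is a countable union of cylinders. -/
theorem measurableSet_coverHits [Countable V] (x₀ : V) (n : ℕ) :
    MeasurableSet {ω : G.edgeSet → Bool | CoverHits G H π x₀ n (G.openEdges ω)} := by
  classical
  have : Countable (Sym2 V) := inferInstanceAs (Countable (Quot _))
  have hset : {ω : G.edgeSet → Bool | CoverHits G H π x₀ n (G.openEdges ω)} =
      ⋃ S : {S : Finset G.edgeSet // CoverHits G H π x₀ n (Subtype.val '' (S : Set G.edgeSet))},
        ⋂ e ∈ S.1, {ω | ω e = true} := by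
    ext ω
    simp only [Set.mem_iUnion, Set.mem_iInter]
    constructor
    · rintro ⟨y, hy, hr⟩
      have : ∃ S : Finset G.edgeSet, (∀ e ∈ S, ω e = true) ∧
          ReflTransGen (OpenStep G (Subtype.val '' (S : Set G.edgeSet))) x₀ y := by
        clear hy
        induction hr with
        | refl => exact ⟨∅, by simp, .refl⟩
        | @tail a b _ hab ih =>
          obtain ⟨S, hS, hr⟩ := ih
          obtain ⟨h1, h2, h3⟩ := hab
          refine ⟨insert ⟨s(a, b), h2⟩ S, ?_, ?_⟩
          · intro e he
            rcases Finset.mem_insert.1 he with rfl | he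
            · exact h3
            · exact hS e he
          · refine (OpenStep.reach_mono ?_ hr).tail ⟨h1, ⟨s(a, b), h2⟩, by simp, rfl⟩
            exact Set.image_mono (by simp)
      obtain ⟨S, hS, hr⟩ := this
      exact ⟨⟨S, y, hy, hr⟩, hS⟩
    · rintro ⟨⟨S, hS⟩, h⟩
      refine CoverHits.mono hS ?_
      rintro _ ⟨e, he, rfl⟩
      exact ⟨e.2, h e he⟩
  rw [hset]
  refine MeasurableSet.iUnion fun S => Finset.measurableSet_biInter _ fun e _ => ?_
  exact (measurable_pi_apply e : Measurable fun ω : G.edgeSet → Bool => ω e)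
    (MeasurableSet.of_discrete (s := ({true} : Set Bool)))

/-- The events decrease in `n`, and on their intersection the cluster of `x₀` has unbounded
projection, hence is infinite. -/
theorem exists_coverHits_lt [Countable V] {p : unitInterval}
    (h : ∀ᵐ ω ∂(G.bondPercolation p), ¬ G.HasInfiniteCluster ω) (x₀ : V) {θ : ENNReal}
    (hθ : 0 < θ) :
    ∃ n, G.bondPercolation p {ω | CoverHits G H π x₀ n (G.openEdges ω)} < θ := by
  set A : ℕ → Set (G.edgeSet → Bool) := fun n =>
    {ω | CoverHits G H π x₀ n (G.openEdges ω)} with hA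
  have hanti : Antitone A := by
    rintro m n hmn ω ⟨y, hy, hr⟩
    exact ⟨y, hmn.trans hy, hr⟩
  have hnull : G.bondPercolation p (⋂ n, A n) = 0 := by
    refine measure_mono_null (fun ω hω => ?_) (ae_iff.1 h)
    rw [Set.mem_iInter] at hω
    change ¬¬ G.HasInfiniteCluster ω
    rw [not_not]
    refine ⟨(G.openSubgraph ω).connectedComponentMk x₀, fun hfin => ?_⟩
    obtain ⟨n, hn⟩ := (hfin.image fun y => H.dist (π x₀) (π y)).bddAbove
    obtain ⟨y, hy, hr⟩ := hω (n + 1)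
    have hmem : y ∈ ((G.openSubgraph ω).connectedComponentMk x₀).supp := by
      rw [ConnectedComponent.mem_supp_iff, ConnectedComponent.eq]
      exact (reachable_openSubgraph_iff.2 hr).symm
    have := hn ⟨y, hmem, rfl⟩
    simp only at this
    omega
  have hlim := tendsto_measure_iInter_atTop (μ := G.bondPercolation p)
    (fun n => (measurableSet_coverHits (G := G) (H := H) (π := π) x₀ n).nullMeasurableSet) hanti
    ⟨0, measure_ne_top _ _⟩
  rw [hnull] at hlim
  exact (hlim.eventually_lt_const hθ).exists

theorem coverHits_of_infinite (hH : H.Connected) (hlf : ∀ v, (H.neighborSet v).Finite)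
    {ω : H.edgeSet → Bool} {o : W}
    (h : ((H.openSubgraph ω).connectedComponentMk o).supp.Infinite) (n : ℕ) :
    CoverHits H H id o n (H.openEdges ω) := by
  obtain ⟨v, hv, hvn⟩ := h.exists_notMem_finite (hH.finite_distBall hlf o n)
  rw [ConnectedComponent.mem_supp_iff, ConnectedComponent.eq] at hv
  exact ⟨v, (not_le.1 hvn).le, reachable_openSubgraph_iff.1 hv.symm⟩

theorem exists_forall_le_coverHits (hH : H.Connected) (hlf : ∀ v, (H.neighborSet v).Finite)
    {p : unitInterval} (h : ¬ ∀ᵐ ω ∂(H.bondPercolation p), ¬ H.HasInfiniteCluster ω) :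
    ∃ o, ∃ θ : ENNReal, 0 < θ ∧
      ∀ n, θ ≤ H.bondPercolation p {ω | CoverHits H H id o n (H.openEdges ω)} := by
  have : Countable W := hH.countable hlf
  by_contra hc
  push Not at hc
  -- By countability it is enough to treat one root at a time; if none had a uniform lower bound,
  -- each would have an infinite cluster with probability zero.
  refine h (ae_iff.2 (measure_mono_null (t := ⋃ o, {ω : H.edgeSet → Bool |
    ((H.openSubgraph ω).connectedComponentMk o).supp.Infinite}) ?_ ?_))
  · intro ω hω
    obtain ⟨C, hC⟩ := not_not.1 hω
    induction C using ConnectedComponent.ind with | h o => ?_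
    exact Set.mem_iUnion.2 ⟨o, hC⟩
  · refine measure_iUnion_null fun o => ?_
    by_contra h0
    obtain ⟨n, hn⟩ := hc o _ (pos_iff_ne_zero.2 h0)
    exact absurd (measure_mono fun ω hω => coverHits_of_infinite hH hlf hω n) (not_le.2 hn)

/-! ### Subcriticality for small parameters -/

/-- There is a trail of length `n` from `x` inside `A`. -/
def HasTrail (H : SimpleGraph W) : ℕ → W → Set (Sym2 W) → Prop
  | 0, _, _ => True
  | n + 1, x, A => ∃ y, H.Adj x y ∧ s(x, y) ∈ A ∧ HasTrail H n y (A \ {s(x, y)})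

theorem HasTrail.mono {n : ℕ} {x : W} {A A' : Set (Sym2 W)} (h : HasTrail H n x A) (hA : A ⊆ A') :
    HasTrail H n x A' := by
  induction n generalizing x A A' with
  | zero => trivial
  | succ n ih =>
    obtain ⟨y, h1, h2, h3⟩ := h
    exact ⟨y, h1, hA h2, ih h3 (Set.sdiff_subset_sdiff_left hA)⟩

theorem hasTrail_of_isTrail {K : SimpleGraph W} (hK : K ≤ H) {x y : W} (w : K.Walk x y)
    (hw : w.IsTrail) {A : Set (Sym2 W)} (hA : ∀ e ∈ w.edges, e ∈ A) {n : ℕ} (hn : n ≤ w.length) :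
    HasTrail H n x A := by
  induction w generalizing A n with
  | nil =>
    obtain rfl : n = 0 := by simpa using hn
    trivial
  | @cons a b c hab w ih =>
    cases n with
    | zero => trivial
    | succ n =>
      rw [Walk.isTrail_cons] at hw
      have hA' : ∀ e ∈ w.edges, e ∈ A \ {s(a, b)} := fun e he =>
        ⟨hA e (by simp [he]), fun h => hw.2 (Set.mem_singleton_iff.1 h ▸ he)⟩
      exact ⟨b, hK hab, hA _ (by simp), ih hw.1 hA' (by simpa using hn)⟩

theorem CoverHits.hasTrail {o : W} {n : ℕ} {A : Set (Sym2 W)} (h : CoverHits H H id o n A) :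
    HasTrail H n o A := by
  obtain ⟨v, hv, hr⟩ := h
  let K : SimpleGraph W :=
    { Adj := OpenStep H A
      symm := ⟨fun a b hab => ⟨hab.1.symm, by rw [Sym2.eq_swap]; exact hab.2⟩⟩
      loopless := ⟨fun a ha => H.irrefl ha.1⟩ }
  have hK : K ≤ H := fun a b hab => hab.1
  have hreach : K.Reachable o v := (reachable_iff_reflTransGen o v).2 hr
  obtain ⟨w, hw⟩ := hreach.exists_isPath
  refine hasTrail_of_isTrail hK w hw.isTrail (fun e he => ?_) (hv.trans ?_)
  · have := w.edges_subset_edgeSet he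
    induction e using Sym2.ind with | h a b => ?_
    exact this.2
  · have := dist_le (w.mapLe hK)
    simpa using this

/-- First moment bound. Deleting the edge just used makes the rest of the trail independent of it,
so each step contributes at most `d * p`. -/
theorem bernoulliExp_hasTrail_le {p : ℝ} (hp0 : 0 ≤ p) (hp1 : p ≤ 1) {d : ℕ}
    (hlf : ∀ v, (H.neighborSet v).Finite) (hd : ∀ v, (H.neighborSet v).ncard ≤ d)
    (S : Finset (Sym2 W)) (n : ℕ) (x : W) :
    bernoulliExp S (fun _ => p) (fun A => propInd (HasTrail H n x A)) ≤ (d * p) ^ n := by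
  classical
  have h0 : ∀ e ∈ S, 0 ≤ (fun _ : Sym2 W => p) e := fun _ _ => hp0
  have h1 : ∀ e ∈ S, (fun _ : Sym2 W => p) e ≤ 1 := fun _ _ => hp1
  induction n generalizing x with
  | zero =>
    rw [pow_zero, ← bernoulliExp.const (S := S) (p := fun _ => p) 1]
    exact bernoulliExp.mono h0 h1 fun A _ => propInd_le_one _
  | succ n ih =>
    set B := (hlf x).toFinset with hB
    have hBc : B.card ≤ d := by
      rw [hB, ← Set.ncard_eq_toFinset_card _ (hlf x)]
      exact hd x
    have step : bernoulliExp S (fun _ => p) (fun A => propInd (HasTrail H (n + 1) x A)) ≤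
        ∑ y ∈ B, bernoulliExp S (fun _ => p)
          (fun A => propInd (s(x, y) ∈ A ∧ HasTrail H n y (A \ {s(x, y)}))) := by
      rw [← bernoulliExp.sum]
      refine bernoulliExp.mono h0 h1 fun A _ => ?_
      by_cases h : HasTrail H (n + 1) x A
      · obtain ⟨y, hy, hyA, hr⟩ := h
        have hyB : y ∈ B := by rw [hB, Set.Finite.mem_toFinset]; exact hy
        refine (propInd_le_one _).trans ?_
        rw [← propInd_of (P := s(x, y) ∈ A ∧ HasTrail H n y (A \ {s(x, y)})) ⟨hyA, hr⟩]
        exact Finset.single_le_sum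
          (f := fun y => propInd (s(x, y) ∈ A ∧ HasTrail H n y (A \ {s(x, y)})))
          (fun _ _ => propInd_nonneg _) hyB
      · rw [propInd_of_not h]
        exact Finset.sum_nonneg fun _ _ => propInd_nonneg _
    have term : ∀ y, bernoulliExp S (fun _ => p)
        (fun A => propInd (s(x, y) ∈ A ∧ HasTrail H n y (A \ {s(x, y)}))) ≤ p * (d * p) ^ n := by
      intro y
      by_cases he : s(x, y) ∈ S
      · rw [bernoulliExp.cond he]
        have z : bernoulliExp S (fun _ => p) (fun A => propInd (s(x, y) ∈ A \ {s(x, y)} ∧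
            HasTrail H n y ((A \ {s(x, y)}) \ {s(x, y)}))) = 0 := by
          rw [← bernoulliExp.const (S := S) (p := fun _ => p) 0]
          exact bernoulliExp.congr fun A _ => propInd_of_not fun h => h.1.2 rfl
        rw [z, mul_zero, add_zero]
        refine mul_le_mul_of_nonneg_left (le_trans ?_ (ih y)) hp0
        refine bernoulliExp.mono h0 h1 fun A _ => propInd_mono fun h => h.2.mono ?_
        rintro e ⟨he1, he2⟩
        exact he1.resolve_left he2
      · have z : bernoulliExp S (fun _ => p) (fun A => propInd (s(x, y) ∈ A ∧
            HasTrail H n y (A \ {s(x, y)}))) = 0 := by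
          rw [← bernoulliExp.const (S := S) (p := fun _ => p) 0]
          exact bernoulliExp.congr fun A hA => propInd_of_not fun h => he (hA h.1)
        rw [z]
        positivity
    refine step.trans ((Finset.sum_le_sum fun y _ => term y).trans ?_)
    rw [Finset.sum_const, nsmul_eq_mul, pow_succ]
    have hq : 0 ≤ p * (d * p) ^ n := by positivity
    calc (B.card : ℝ) * (p * (d * p) ^ n) ≤ d * (p * (d * p) ^ n) :=
          mul_le_mul_of_nonneg_right (by exact_mod_cast hBc) hq
      _ = (d * p) ^ n * (d * p) := by ring

theorem ae_not_hasInfiniteCluster (hH : H.Connected) (hlf : ∀ v, (H.neighborSet v).Finite) {d : ℕ}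
    (hd : ∀ v, (H.neighborSet v).ncard ≤ d) {p : unitInterval} (hp : d * (p : ℝ) < 1) :
    ∀ᵐ ω ∂(H.bondPercolation p), ¬ H.HasInfiniteCluster ω := by
  by_contra hc
  obtain ⟨o, θ, hθ, h⟩ := exists_forall_le_coverHits hH hlf hc
  have hle : ∀ n, θ ≤ ENNReal.ofReal ((d * (p : ℝ)) ^ n) := fun n => by
    refine (h n).trans ((bondPercolation_le_ballEdges hH hlf p o n).trans
      (ENNReal.ofReal_le_ofReal ?_))
    refine le_trans ?_ (bernoulliExp_hasTrail_le p.2.1 p.2.2 hlf hd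
      (finite_ballEdges hH hlf o n).toFinset n o)
    exact bernoulliExp.mono (fun _ _ => p.2.1) (fun _ _ => p.2.2) fun A _ =>
      propInd_mono fun h => h.hasTrail
  have hlim : Tendsto (fun n : ℕ => ENNReal.ofReal ((d * (p : ℝ)) ^ n)) atTop (nhds 0) := by
    have := ENNReal.tendsto_ofReal (tendsto_pow_atTop_nhds_zero_of_lt_one
      (mul_nonneg (Nat.cast_nonneg d) p.2.1) hp)
    simpa using this
  exact absurd (ge_of_tendsto' hlim hle) (not_le.2 hθ)

theorem bddAbove_criticalSet (G : SimpleGraph V) : BddAbove {p : ℝ | ∃ hp : p ∈ unitInterval,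
    ∀ᵐ ω ∂(G.bondPercolation ⟨p, hp⟩), ¬ G.HasInfiniteCluster ω} :=
  ⟨1, fun _ ⟨hp, _⟩ => hp.2⟩

/-- Positivity is what later allows edge parameters bounded away from `0`, as the modification
argument demands. -/
theorem criticalParameter_pos (hH : H.Connected) (hlf : ∀ v, (H.neighborSet v).Finite) {d : ℕ}
    (hd : ∀ v, (H.neighborSet v).ncard ≤ d) : 0 < H.criticalParameter := by
  have hd0 : (0 : ℝ) < d + 1 := by positivity
  have hp : (1 / (d + 1) : ℝ) ∈ unitInterval := by
    refine ⟨by positivity, ?_⟩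
    rw [div_le_one hd0]
    simp
  refine lt_of_lt_of_le (show (0 : ℝ) < 1 / (d + 1) by positivity)
    (le_csSup (bddAbove_criticalSet H) ⟨hp, ae_not_hasInfiniteCluster hH hlf hd ?_⟩)
  simp only
  rw [mul_one_div, div_lt_one hd0]
  linarith

end SimpleGraph

/-! ### Strict inequality of the critical parameters -/

open SimpleGraph in
theorem corollary2p2 {V : Type*} (𝒢 : SimpleGraph V)
    (hconn : 𝒢.Connected) (hlf : ∀ v : V, (𝒢.neighborSet v).Finite)
    {Γ : Type*} [Group Γ] [Nontrivial Γ] [MulAction Γ V]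
    (haut : ∀ (g : Γ) (x y : V), 𝒢.Adj (g • x) (g • y) ↔ 𝒢.Adj x y)
    (hfree : ∀ g : Γ, g ≠ 1 → ∀ x : V, g • x ≠ x)
    (hG : 𝒢.IsQuasiTransitive)
    (hH : (𝒢.orbitQuotient Γ).IsQuasiTransitive)
    (hpc : 𝒢.criticalParameter < 1) :
    𝒢.criticalParameter < (𝒢.orbitQuotient Γ).criticalParameter := by
  set H := 𝒢.orbitQuotient Γ with hHdef
  have hHconn : H.Connected := hconn.orbitQuotient
  have hHlf : ∀ v, (H.neighborSet v).Finite := orbitQuotient_neighborSet_finite haut hlf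
  have : Countable V := hconn.countable hlf
  obtain ⟨r, hr⟩ := exists_forall_dist_smul_le hconn hlf haut hfree hG hH
  obtain ⟨b, hb⟩ := hH.exists_ncard_distBall_le hHconn (4 * r + 6)
  obtain ⟨d, hd⟩ := hH.exists_ncard_distBall_le hHconn 1
  obtain ⟨k, hk⟩ := hG.exists_ncard_distBall_le hconn (2 * r + 1)
  have hdeg : ∀ v, (H.neighborSet v).ncard ≤ d := fun v => le_trans (Set.ncard_le_ncard
    (fun w hw => (dist_eq_one_iff_adj.2 hw).le) (hHconn.finite_distBall hHlf v 1)) (hd v)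
  set pc := H.criticalParameter with hpcdef
  have hpc0 : 0 < pc := criticalParameter_pos hHconn hHlf hdeg
  rcases le_or_gt 1 pc with hpc1 | hpc1
  · exact hpc.trans_le hpc1
  set c := min (pc / 2) ((1 - pc) / 2) with hc
  have hc1 : c ≤ pc / 2 := min_le_left _ _
  have hc2 : c ≤ (1 - pc) / 2 := min_le_right _ _
  have hc0 : 0 < c := lt_min (by linarith) (by linarith)
  obtain ⟨κ, hκ, hrate⟩ := exists_interpolation_rate (r := r) hHconn hHlf hb hc0 (by linarith)
  -- The three bounds serve respectively the interpolation, the comparison with the cover (through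
  -- `c ≤ q`), and the condition that `q` stay above `c`.
  set s := min (min (1 / 2) (c ^ (k ^ 2))) (pc / (4 * κ)) with hs
  have hs0 : 0 < s := lt_min (lt_min (by norm_num) (pow_pos hc0 _)) (by positivity)
  have hs1 : s ≤ 1 / 2 := (min_le_left _ _).trans (min_le_left _ _)
  have hs2 : s ≤ c ^ (k ^ 2) := (min_le_left _ _).trans (min_le_right _ _)
  have hs3 : κ * s ≤ pc / 4 := by
    have : s ≤ pc / (4 * κ) := min_le_right _ _
    rw [le_div_iff₀ (by positivity)] at this
    linarith
  have hκs : 0 < κ * s := mul_pos hκ hs0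
  -- Above `pc` by less than the gain `κ * s`, so that `q = p₀ - κ * s` falls below `pc`, and small
  -- enough for `p₀ ≤ 1 - c`.
  set p₀ := pc + min (κ * s / 2) ((1 - pc) / 4) with hp₀
  have hm0 : 0 < min (κ * s / 2) ((1 - pc) / 4) := lt_min (by linarith) (by linarith)
  have hm1 : min (κ * s / 2) ((1 - pc) / 4) ≤ κ * s / 2 := min_le_left _ _
  have hm2 : min (κ * s / 2) ((1 - pc) / 4) ≤ (1 - pc) / 4 := min_le_right _ _
  have hp₀I : p₀ ∈ unitInterval := ⟨by linarith, by linarith⟩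
  set q := p₀ - κ * s with hq
  have hcq : c ≤ q := by linarith
  -- above the critical parameter the quotient percolates
  have hinf : ¬ ∀ᵐ ω ∂(H.bondPercolation ⟨p₀, hp₀I⟩), ¬ H.HasInfiniteCluster ω := fun h => by
    have := le_csSup (bddAbove_criticalSet H) ⟨hp₀I, h⟩
    change p₀ ≤ pc at this
    linarith
  obtain ⟨o, θ, hθ, hθle⟩ := exists_forall_le_coverHits hHconn hHlf hinf
  obtain ⟨x₀, rfl⟩ : ∃ x₀, orbitProj Γ x₀ = o := Quotient.exists_rep o
  refine lt_of_le_of_lt (Real.sSup_le ?_ ?_) (show q < pc by linarith)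
  -- For `p' > q` without infinite clusters, `N` is chosen on the cover first; the interpolation
  -- then supplies the radius `n` at which percolation on the quotient contradicts it.
  · rintro p' ⟨hp'I, hp'⟩
    by_contra hlt
    rw [not_le] at hlt
    obtain ⟨N, hN⟩ := exists_coverHits_lt (H := H) (π := orbitProj Γ) hp' x₀ hθ
    obtain ⟨n, -, hn⟩ := hrate (orbitProj Γ x₀) N p₀ s hs0.le hs1 hcq (by linarith)
    obtain ⟨S, hS⟩ := seedHits_le_coverHits hconn hHconn hlf (orbitProj_lift haut)
      (exists_two_lifts hconn haut hfree hr) hk (p := q) (s := s) (by linarith) (by linarith) hs0.le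
      (hs2.trans (pow_le_pow_left₀ hc0.le hcq _)) x₀ N
      (finite_itemBox hHconn hHlf (orbitProj Γ x₀) (N + r)).toFinset
    have h1 := (hθle n).trans (bondPercolation_le_ballEdges hHconn hHlf _ _ n)
    have h2 := ballEdges_le_seedHits hHconn hHlf hp₀I.1 hp₀I.2 r (orbitProj Γ x₀) n
    have h3 : bernoulliExp S (fun _ => q) (fun A => propInd (CoverHits 𝒢 H (orbitProj Γ) x₀ N A)) ≤
        bernoulliExp S (fun _ => p')
          (fun A => propInd (CoverHits 𝒢 H (orbitProj Γ) x₀ N A)) :=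
      bernoulliExp.mono_weight (fun _ _ => by linarith) (fun _ _ => hp'I.2) (fun _ _ => hlt.le)
        fun A B hAB => propInd_mono fun h => h.mono hAB
    have h4 := coverHits_le_bondPercolation (G := 𝒢) (H := H) (π := orbitProj Γ) ⟨p', hp'I⟩ x₀ N S
    refine absurd ?_ (not_le.2 hN)
    exact h1.trans ((ENNReal.ofReal_le_ofReal (h2.trans (hn.trans (hS.trans h3)))).trans h4)
  · linarith
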